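/- Let $d\ge 2$. To each undirected edge $\{x,y\}$ between nearest neighbors $x,y\in\mathbb Z^d$ assign a non-negative (finite) random variable $c(\{x,y\})$, its conductance. Put $q(x)=\sum_{y:\|y-x\|_1=1}c(\{x,y\})$, and let $\varkappa(x,y)=c(\{x,y\})/q(x)$ for nearest neighbors $x,y$ with $q(x)\neq 0$, $\varkappa(x,x)=1$ if $q(x)=0$, and $\varkappa(x,y)=0$ in all other cases. The cluster $\mathcal C(x)$ consists of $x$ and of all $y\in\mathbb Z^d$ that are joined to $x$ by a nearest-neighbor path along which all conductances are strictly positive. Assume that the family of conductances is stationary and ergodic with respect to the shifts of $\mathbb Z^d$, that $E[q(0)]<\infty$, and that almost surely there is at most one infinite cluster. (Here ergodic means: $P[A]\in\{0,1\}$ for every event $A$ for which there is a measurable set $B$ such that, for all $z\in\mathbb Z^d$, $A$ coincides up to a null set with the event that the family of conductances shifted by $z$ lies in $B$.) Given the conductances, let the frog trajectories $(S_j(x,i))_{j\ge 0}$, $x\in\mathbb Z^d$, $i\ge 1$, be independent Markov chains with transition matrix $\varkappa$ and $S_0(x,i)=x$. Let the numbers $\eta(x)\in\{0,1,2,\dots\}$,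 $x\in\mathbb Z^d$, of sleeping frogs be i.i.d. and independent of the pair formed by the conductances and the frog trajectories. For $v\in\mathbb Z^d$ put $W^v_0=\{v\}$ and, for $j\ge 1$, let $W^v_j$ be the set of all $x\notin\bigcup_{k<j}W^v_k$ such that $S_{j-k}(y,i)=x$ for some $k<j$, $y\in W^v_k$ and $1\le i\le\eta(y)$; let $W^v=\bigcup_{j\ge 0}W^v_j$. The site $v$ is called recurrent if there are infinitely many distinct $x\in W^v$ for which there are $i\in\{1,\dots,\eta(x)\}$ and $j\ge 0$ with $S_j(x,i)=v$; otherwise $v$ is called transient. Then either with probability 1 every $x\in\mathbb Z^d$ is transient, or with probability 1 every $x\in\mathbb Z^d$ with $\eta(x)\ge 1$ and $\#\mathcal C(x)=\infty$ is recurrent. -/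

import Mathlib

open MeasureTheory ProbabilityTheory
open scoped NNReal ENNReal

noncomputable section

namespace FrogRCM

/-! ### Frog configurations, recurrence and transience of a site -/

section Frogs

variable {V : Type*}

/-- For frog numbers `n` and trajectories `s` (`s j x i` is the position after `j` steps of the
`i`-th frog of site `x`, `i ≥ 1`), `firstVisited n s v j` is the set of sites visited for the
first time at time `j` by an active frog, when the frogs at `v` are woken up at time `0`. -/
def firstVisited (n : V → ℕ) (s : ℕ → V → ℕ+ → V) (v : V) : ℕ → Set V
  | 0 => {v}
  | j + 1 => {x | (∀ k : Fin (j + 1), x ∉ firstVisited n s v k.1) ∧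
      ∃ k : Fin (j + 1), ∃ y ∈ firstVisited n s v k.1, ∃ i : ℕ+,
        (i : ℕ) ≤ n y ∧ s (j + 1 - k.1) y i = x}

/-- The set of all sites that are ever visited when the frogs at `v` are woken up. -/
def visited (n : V → ℕ) (s : ℕ → V → ℕ+ → V) (v : V) : Set V :=
  ⋃ j : ℕ, firstVisited n s v j

/-- `v` is recurrent: waking up the frogs at `v` makes active frogs from infinitely many distinct
sites visit `v`. -/
def Recurrent (n : V → ℕ) (s : ℕ → V → ℕ+ → V) (v : V) : Prop :=
  {x | x ∈ visited n s v ∧ ∃ i : ℕ+, (i : ℕ) ≤ n x ∧ ∃ j : ℕ, s j x i = v}.Infinite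

/-- `v` is transient if it is not recurrent. -/
def Transient (n : V → ℕ) (s : ℕ → V → ℕ+ → V) (v : V) : Prop :=
  ¬ Recurrent n s v

end Frogs

/-! ### The lattice and conductances on its nearest-neighbor edges -/

/-- The sites of `ℤ^d`. -/
abbrev Site (d : ℕ) : Type := Fin d → ℤ

/-- The nearest-neighbor graph on `ℤ^d`: `x` and `y` are adjacent iff `‖x - y‖₁ = 1`. -/
def lattice (d : ℕ) : SimpleGraph (Site d) where
  Adj x y := ∑ i, |x i - y i| = 1
  symm := ⟨fun x y h => by simpa only [abs_sub_comm] using h⟩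
  loopless := ⟨fun x h => by simp at h⟩

instance (d : ℕ) : DecidableRel (lattice d).Adj :=
  fun x y => inferInstanceAs (Decidable (∑ i, |x i - y i| = 1))

/-- The finite set of nearest neighbors of `x`. -/
def neighbors {d : ℕ} (x : Site d) : Finset (Site d) :=
  (Finset.Icc (fun i => x i - 1) (fun i => x i + 1)).filter fun y => (lattice d).Adj x y

theorem mem_neighbors {d : ℕ} (x y : Site d) : y ∈ neighbors x ↔ (lattice d).Adj x y := by
  simp only [neighbors, Finset.mem_filter, Finset.mem_Icc, and_iff_right_iff_imp]
  intro h
  have h' : ∑ i, |x i - y i| = 1 := h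
  have key : ∀ i, |x i - y i| ≤ 1 := fun i => by
    rw [← h']
    exact Finset.single_le_sum (f := fun i => |x i - y i|) (fun _ _ => abs_nonneg _)
      (Finset.mem_univ i)
  constructor <;> intro i <;> have := abs_le.1 (key i) <;> simp only <;> linarith

/-- Conductance configurations: a nonnegative number for each undirected nearest-neighbor edge,
with the product σ-algebra. -/
abbrev Env (d : ℕ) : Type := (lattice d).edgeSet → ℝ≥0

/-- The conductance `c({x,y})`, extended by `0` to pairs that are not nearest neighbors. -/
def conductance {d : ℕ} (c : Env d) (x y : Site d) : ℝ≥0 :=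
  if h : (lattice d).Adj x y then c ⟨s(x, y), h⟩ else 0

/-- `q(x) = ∑_{y : ‖y - x‖₁ = 1} c({x,y})`. -/
def totalConductance {d : ℕ} (c : Env d) (x : Site d) : ℝ≥0 :=
  ∑ y ∈ neighbors x, conductance c x y

open Classical in
/-- The transition matrix of the random walk among the conductances `c`; the walk stays put at
sites all of whose edges have conductance `0`. -/
def transition {d : ℕ} (c : Env d) (x y : Site d) : ℝ :=
  if totalConductance c x = 0 then (if y = x then 1 else 0)
  else (conductance c x y : ℝ) / (totalConductance c x : ℝ)

/-- The cluster of `x`: all sites joined to `x` by a nearest-neighbor path of edges with positive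
conductance (including `x` itself). -/
def cluster {d : ℕ} (c : Env d) (x : Site d) : Set (Site d) :=
  {y | Relation.ReflTransGen (fun u v => 0 < conductance c u v) x y}

/-- Translation by `z` as a map of the nearest-neighbor graph. -/
def shiftHom {d : ℕ} (z : Site d) : lattice d →g lattice d where
  toFun x := x + z
  map_rel' := fun {x y} h => by
    have h' : ∑ i, |x i - y i| = 1 := h
    show ∑ i, |(x + z) i - (y + z) i| = 1
    simpa using h'

/-- The shifted conductances, `(shiftEnv z c)({x,y}) = c({x+z,y+z})`. -/
def shiftEnv {d : ℕ} (z : Site d) (c : Env d) : Env d :=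
  fun e => c ((shiftHom z).mapEdgeSet e)

/-! ### Probabilistic notions -/

section Probability

variable {Ω : Type*} [MeasurableSpace Ω]

/-- The random conductances `c` are stationary with respect to the shifts on `ℤ^d`. -/
def Stationary {d : ℕ} (P : Measure Ω) (c : Ω → Env d) : Prop :=
  ∀ z : Site d, P.map (fun ω => shiftEnv z (c ω)) = P.map c

/-- The random conductances `c` are ergodic with respect to the shifts on `ℤ^d`: almost invariant
events have probability `0` or `1`. -/
def ErgodicShifts {d : ℕ} (P : Measure Ω) (c : Ω → Env d) : Prop :=
  ∀ A : Set Ω, MeasurableSet A → ∀ B : Set (Env d), MeasurableSet B →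
    (∀ z : Site d, A =ᵐ[P] {ω | shiftEnv z (c ω) ∈ B}) → P A = 0 ∨ P A = 1

/-- The random elements `X f`, `f : ι`, are conditionally independent given the σ-algebra `m`. -/
def CondIndepGiven {ι β : Type*} [MeasurableSpace β] (P : Measure Ω) (m : MeasurableSpace Ω)
    (X : ι → Ω → β) : Prop :=
  ∀ (F : Finset ι) (B : ι → Set β), (∀ f ∈ F, MeasurableSet (B f)) →
    P⟦⋂ f ∈ F, X f ⁻¹' B f | m⟧ =ᵐ[P] fun ω => ∏ f ∈ F, (P⟦X f ⁻¹' B f | m⟧) ω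

/-- Given the conductances `c`, the process `Y` is a Markov chain started at `x` whose transition
matrix is that of the random walk among the conductances. -/
def IsWalkGiven {d : ℕ} (P : Measure Ω) (c : Ω → Env d) (x : Site d) (Y : Ω → ℕ → Site d) :
    Prop :=
  ∀ (m : ℕ) (p : ℕ → Site d),
    P⟦{ω | ∀ j ≤ m, Y ω j = p j} | MeasurableSpace.comap c inferInstance⟧ =ᵐ[P]
      fun ω => (if p 0 = x then 1 else 0) *
        ∏ j ∈ Finset.range m, transition (c ω) (p j) (p (j + 1))

end Probability

end FrogRCM

end

/-! The frogs are first realised on a canonical space: conductances of law `ν` and, at each site,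
independent noise consisting of a frog number and uniform variables that drive the walks. A walk
moves by reading the environment seen from its current position, so shifts act on the whole model
(`shiftModel`), preserve its law, and carry recurrent sites to recurrent sites. "Some site is
recurrent" is therefore an invariant event. Since the noise is i.i.d. over sites and the
conductances are ergodic, a mixing argument (`lintegral_section_le_sq`, `modelLaw_eq_zero_or_one`)
gives this event probability 0 or 1. Probability 0 is the transient alternative.

Suppose the probability is 1, and let the cluster of `x` be infinite. A recurrent site has an
infinite cluster, so by uniqueness the cluster of `x` contains a recurrent site. Three ingredients
then make `x` recurrent as soon as it has a frog.

(a) Let `recProb ω x` be the probability that a fresh walk from `x` hits a recurrent site. It is a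
bounded stationary superharmonic function. The conductances are symmetric and integrable, so its
Dirichlet form has mean zero (`ae_eq_of_superharmonic`) and it is constant on clusters. It equals 1
at recurrent sites, hence on the whole cluster of `x` (`ae_recProb_eq_one`).

(b) Replace the noise at `x` by an independent copy. By (a) the first new frog of `x`, if there is
one, hits a recurrent site `v`. The old process from `v` brings infinitely many visitors to `v`.
Each of them, apart possibly from `x`, is also found by the process from `x`, either with the old
noise or with the new one (`visitors_infinite_or`).

(c) Infinitely many visitors at `v` almost surely force infinitely many at every site of its
cluster, in particular at `x` (`ae_visitors_infinite`). A site's frogs visit the second place with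
probability at least a fixed multiple of that for the first, and a conditional Borel-Cantelli
argument along the exploration concludes (`ae_infinite_reachIn_of_le`). Its engine is the mean-one
product `lintegral_prod_reachIn`.

By (a)-(c), `x` is recurrent before or after the resampling. The two versions are exchangeable and
independent given everything else, so neither can be exceptional with positive probability
(`ae_notMem_of_resample`). Finally, `map_eq_modelLaw_map` identifies the law of the given frogs with
the canonical one. -/

noncomputable section

namespace FrogRCM

/-! ### Resampling coordinates of infinite product measures -/

section Resampling

theorem measurePreserving_update {ι : Type*} [DecidableEq ι] {X : ι → Type*}
    [∀ i, MeasurableSpace (X i)]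
    (μ : ∀ i, Measure (X i)) [∀ i, IsProbabilityMeasure (μ i)] (i : ι) :
    MeasurePreserving (fun p : (∀ j, X j) × X i => Function.update p.1 i p.2)
      ((Measure.infinitePi μ).prod (μ i)) (Measure.infinitePi μ) := by
  have hm : Measurable (fun p : (∀ j, X j) × X i => Function.update p.1 i p.2) := by
    refine measurable_pi_lambda _ fun j => ?_
    by_cases h : j = i
    · subst h
      simpa using measurable_snd
    · simp only [Function.update_of_ne h]
      fun_prop
  refine ⟨hm, Measure.eq_infinitePi _ fun s t ht => ?_⟩
  rw [Measure.map_apply hm (.pi s.countable_toSet fun _ _ => ht _)]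
  by_cases hi : i ∈ s
  · have : (fun p : (∀ j, X j) × X i => Function.update p.1 i p.2) ⁻¹' Set.pi s t =
        (Set.pi (s.erase i : Finset ι) t) ×ˢ t i := by
      ext ⟨f, z⟩
      simp only [Set.mem_preimage, Set.mem_pi, Finset.mem_coe, Set.mem_prod, Finset.mem_erase]
      constructor
      · intro h
        refine ⟨fun j hj => ?_, by simpa using h i hi⟩
        simpa [Function.update_of_ne hj.1] using h j hj.2
      · rintro ⟨h1, h2⟩ j hj
        by_cases h : j = i
        · subst h; simpa using h2
        · simpa [Function.update_of_ne h] using h1 j ⟨h, hj⟩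
    rw [this, Measure.prod_prod, Measure.infinitePi_pi _ (fun j _ => ht j),
      Finset.prod_erase_mul _ _ hi]
  · have : (fun p : (∀ j, X j) × X i => Function.update p.1 i p.2) ⁻¹' Set.pi s t =
        (Set.pi s t) ×ˢ Set.univ := by
      ext ⟨f, z⟩
      simp only [Set.mem_preimage, Set.mem_pi, Finset.mem_coe, Set.mem_prod, Set.mem_univ,
        and_true]
      refine forall₂_congr fun j hj => ?_
      rw [Function.update_of_ne (by rintro rfl; exact hi hj)]
    rw [this, Measure.prod_prod, Measure.infinitePi_pi _ (fun j _ => ht j), measure_univ, mul_one]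

/-- Resampling coordinate `i` preserves the law, leaves `F` unchanged and feeds a fresh variable to
`g`; Tonelli then splits the integral. -/
theorem lintegral_mul_coord {ι : Type*} [DecidableEq ι] {X : ι → Type*} [∀ i, MeasurableSpace (X i)]
    (μ : ∀ i, Measure (X i)) [∀ i, IsProbabilityMeasure (μ i)] (i : ι)
    {F : (∀ j, X j) → ℝ≥0∞} (hF : Measurable F)
    (hFi : ∀ f z, F (Function.update f i z) = F f) {g : X i → ℝ≥0∞} (hg : Measurable g) :
    ∫⁻ f, F f * g (f i) ∂Measure.infinitePi μ =
      (∫⁻ f, F f ∂Measure.infinitePi μ) * ∫⁻ z, g z ∂μ i := by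
  have hgi : Measurable fun f : ∀ j, X j => g (f i) := hg.comp (measurable_pi_apply i)
  have hp := (measurePreserving_update μ i).lintegral_comp (f := fun f => F f * g (f i))
    (hF.mul hgi)
  rw [← hp]
  simp only [hFi, Function.update_self]
  rw [lintegral_prod_mul hF.aemeasurable hg.aemeasurable]

theorem measure_inter_coord {ι : Type*} [DecidableEq ι] {X : ι → Type*} [∀ i, MeasurableSpace (X i)]
    (μ : ∀ i, Measure (X i)) [∀ i, IsProbabilityMeasure (μ i)] (i : ι)
    {D : Set (∀ j, X j)} (hD : MeasurableSet D)
    (hDi : ∀ f z, Function.update f i z ∈ D ↔ f ∈ D) {G : Set (X i)} (hG : MeasurableSet G) :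
    Measure.infinitePi μ (D ∩ {f | f i ∈ G}) = Measure.infinitePi μ D * μ i G := by
  have h := lintegral_mul_coord μ i (F := D.indicator 1) (measurable_one.indicator hD)
    (fun f z => by by_cases h : f ∈ D <;> simp [Set.indicator, hDi, h]) (g := G.indicator 1)
    (measurable_one.indicator hG)
  rw [lintegral_indicator_one hD, lintegral_indicator_one hG] at h
  have hG' : MeasurableSet {f : ∀ j, X j | f i ∈ G} := measurable_pi_apply i hG
  rw [← h, ← lintegral_indicator_one (hD.inter hG')]
  congr 1 with f
  by_cases h1 : f ∈ D <;> by_cases h2 : f i ∈ G <;> simp [Set.indicator, h1, h2]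

theorem lintegral_mul_prod_coord {ι X : Type*} [DecidableEq ι] [MeasurableSpace X]
    (μ : ι → Measure X) [∀ i, IsProbabilityMeasure (μ i)] (T : Finset ι)
    {F : (ι → X) → ℝ≥0∞} (hF : Measurable F)
    (hFi : ∀ i ∈ T, ∀ f z, F (Function.update f i z) = F f)
    {g : ι → X → ℝ≥0∞} (hg : ∀ i, Measurable (g i)) (hg1 : ∀ i, ∫⁻ z, g i z ∂μ i = 1) :
    ∫⁻ f, F f * ∏ i ∈ T, g i (f i) ∂Measure.infinitePi μ =
      ∫⁻ f, F f ∂Measure.infinitePi μ := by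
  induction T using Finset.induction_on with
  | empty => simp
  | insert a T ha ih =>
    have hm : Measurable fun f : ι → X => F f * ∏ i ∈ T, g i (f i) :=
      hF.mul (Finset.measurable_prod _ fun i _ => (hg i).comp (measurable_pi_apply i))
    have hinv : ∀ f z, (F (Function.update f a z) * ∏ i ∈ T, g i (Function.update f a z i)) =
        F f * ∏ i ∈ T, g i (f i) := by
      intro f z
      rw [hFi a (Finset.mem_insert_self _ _)]
      congr 1
      refine Finset.prod_congr rfl fun i hi => ?_
      rw [Function.update_of_ne (by rintro rfl; exact ha hi)]
    have := lintegral_mul_coord μ a hm hinv (hg a)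
    rw [hg1, mul_one, ih fun i hi => hFi i (Finset.mem_insert_of_mem hi)] at this
    rw [← this]
    congr 1 with f
    rw [Finset.prod_insert ha]
    ring

end Resampling

/-! ### Reachable sets of random directed graphs with independent out-neighborhoods -/

section Reach

variable {V X : Type*}

/-- The vertices that can be reached from `x` inside `K` when `y` points at `N y (f y)`. -/
def reachIn (N : V → X → Set V) (K : Set V) (x : V) (f : V → X) : Set V :=
  {w | Relation.ReflTransGen (fun a b => a ∈ K ∧ b ∈ K ∧ b ∈ N a (f a)) x w}

theorem reachIn_subset {N : V → X → Set V} {K : Set V} {x : V} (hx : x ∈ K) (f : V → X) :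
    reachIn N K x f ⊆ K := by
  intro w hw
  induction hw with
  | refl => exact hx
  | tail _ h _ => exact h.2.1

theorem reachIn_mono {N : V → X → Set V} {K L : Set V} (h : K ⊆ L) (x : V) (f : V → X) :
    reachIn N K x f ⊆ reachIn N L x f :=
  fun _ hw => Relation.ReflTransGen.mono (fun _ _ hab => ⟨h hab.1, h hab.2.1, hab.2.2⟩) _ _ hw

/-- The exploration from `x` reads `f` only at vertices it has already reached. The reachable set
thus behaves like a stopping set, which is what makes a Wald identity possible. -/
theorem reachIn_congr {N : V → X → Set V} {K : Set V} {x : V} {f f' : V → X}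
    (h : ∀ y ∈ reachIn N K x f, f' y = f y) : reachIn N K x f' = reachIn N K x f := by
  apply Set.Subset.antisymm
  · intro w hw
    induction hw with
    | refl => exact Relation.ReflTransGen.refl
    | tail _ hab ih => exact ih.tail ⟨hab.1, hab.2.1, by rw [← h _ ih]; exact hab.2.2⟩
  · intro w hw
    induction hw with
    | refl => exact Relation.ReflTransGen.refl
    | @tail a b ha hab ih => exact ih.tail ⟨hab.1, hab.2.1, by rw [h _ ha]; exact hab.2.2⟩

theorem exists_finset_mem_reachIn {N : V → X → Set V} {x w : V} {f : V → X}
    (hw : w ∈ reachIn N Set.univ x f) : ∃ F : Finset V, w ∈ reachIn N F x f := by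
  classical
  induction hw with
  | refl => exact ⟨∅, Relation.ReflTransGen.refl⟩
  | @tail a b _ hab ih =>
    obtain ⟨F, hF⟩ := ih
    refine ⟨insert a (insert b F), Relation.ReflTransGen.tail (b := a) ?_ ?_⟩
    · exact reachIn_mono (by intro y hy; simp [Finset.mem_coe.1 hy]) x f hF
    · exact ⟨by simp, by simp, hab.2.2⟩

/-- The reflexive transitive closure of a countable family of measurable relations is
measurable. -/
theorem measurableSet_reflTransGen {Y : Type*} [MeasurableSpace Y] [Countable V]
    {R : Y → V → V → Prop} (hR : ∀ a b, MeasurableSet {y | R y a b}) (x w : V) :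
    MeasurableSet {y | Relation.ReflTransGen (R y) x w} := by
  -- `step n w` is the event that a chain of exactly `n` relations leads from `x` to `w`.
  let step : ℕ → V → Set Y := fun n => Nat.rec (fun w => {_y | x = w})
    (fun _ s w => ⋃ a, s a ∩ {y | R y a w}) n
  have hstep : ∀ n w, MeasurableSet (step n w) := by
    intro n
    induction n with
    | zero => intro w; exact MeasurableSet.const _
    | succ n ih => intro w; exact MeasurableSet.iUnion fun a => (ih a).inter (hR a w)
  have : {y | Relation.ReflTransGen (R y) x w} = ⋃ n, step n w := by
    ext y
    simp only [Set.mem_ofPred_eq, Set.mem_iUnion]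
    constructor
    · intro h
      induction h with
      | refl => exact ⟨0, rfl⟩
      | @tail a b _ hab ih =>
        obtain ⟨n, hn⟩ := ih
        exact ⟨n + 1, Set.mem_iUnion.2 ⟨a, hn, hab⟩⟩
    · rintro ⟨n, hn⟩
      induction n generalizing w with
      | zero => obtain rfl : x = w := hn; exact Relation.ReflTransGen.refl
      | succ n ih =>
        obtain ⟨a, ha, hab⟩ := Set.mem_iUnion.1 hn
        exact (ih a ha).tail hab
  rw [this]
  exact MeasurableSet.iUnion fun n => hstep n w

theorem measurableSet_setOf_infinite {Y : Type*} [MeasurableSpace Y] [Countable V]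
    {p : Y → V → Prop} (hp : ∀ v, MeasurableSet {y | p y v}) :
    MeasurableSet {y | {v | p y v}.Infinite} := by
  have : {y | {v | p y v}.Infinite} = ⋂ F : Finset V, ⋃ v ∈ {v | v ∉ F}, {y | p y v} := by
    ext y
    simp only [Set.mem_ofPred_eq, Set.mem_iInter, Set.mem_iUnion, exists_prop]
    constructor
    · intro h F
      obtain ⟨v, hv, hF⟩ := h.exists_notMem_finset F
      exact ⟨v, hF, hv⟩
    · intro h hfin
      obtain ⟨v, hv, hp⟩ := h hfin.toFinset
      exact hv (hfin.mem_toFinset.2 hp)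
  rw [this]
  exact MeasurableSet.iInter fun F => MeasurableSet.biUnion (Set.to_countable _) fun v _ => hp v

variable [MeasurableSpace X] [Countable V] {N : V → X → Set V}

theorem measurableSet_mem_reachIn (hN : ∀ y w, MeasurableSet {z | w ∈ N y z}) (K : Set V)
    (x w : V) : MeasurableSet {f : V → X | w ∈ reachIn N K x f} := by
  refine measurableSet_reflTransGen
    (R := fun (f : V → X) a b => a ∈ K ∧ b ∈ K ∧ b ∈ N a (f a)) ?_ x w
  intro a b
  have : MeasurableSet {f : V → X | b ∈ N a (f a)} :=
    (measurable_pi_apply a : Measurable fun f : V → X => f a) (hN a b)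
  exact (MeasurableSet.const _).inter ((MeasurableSet.const _).inter this)

open Classical in
/-- Wald's identity for products of independent mean one weights over the reachable set. -/
theorem lintegral_prod_reachIn (hN : ∀ y w, MeasurableSet {z | w ∈ N y z})
    (μ : V → Measure X) [∀ i, IsProbabilityMeasure (μ i)] (K : Finset V) {x : V} (hx : x ∈ K)
    {g : V → X → ℝ≥0∞} (hg : ∀ i, Measurable (g i)) (hg1 : ∀ i, ∫⁻ z, g i z ∂μ i = 1) :
    ∫⁻ f, ∏ y ∈ K.filter (· ∈ reachIn N K x f), g y (f y) ∂Measure.infinitePi μ = 1 := by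
  have hms : ∀ w : Finset V, MeasurableSet {f : V → X | K.filter (· ∈ reachIn N K x f) = w} := by
    intro w
    have : {f : V → X | K.filter (· ∈ reachIn N K x f) = w} =
        ⋂ y : V, {f | (y ∈ K ∧ y ∈ reachIn N K x f) ↔ y ∈ w} := by
      ext f
      simp [Finset.ext_iff]
    rw [this]
    refine MeasurableSet.iInter fun y => ?_
    exact ((MeasurableSet.const _).inter (measurableSet_mem_reachIn hN K x y)).iff
      (MeasurableSet.const _)
  have hprod : ∀ T : Finset V, Measurable fun f : V → X => ∏ y ∈ T, g y (f y) := fun T =>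
    Finset.measurable_prod _ fun i _ => (hg i).comp (measurable_pi_apply i)
  -- The event that the explored set is exactly `w` is decided by the coordinates in `w` alone.
  have hcongr : ∀ (w : Finset V), w ⊆ K → ∀ i ∈ K \ w, ∀ (f : V → X) z,
      K.filter (· ∈ reachIn N K x (Function.update f i z)) = w ↔
        K.filter (· ∈ reachIn N K x f) = w := by
    have key : ∀ (w : Finset V) (f f' : V → X), (∀ y ∈ w, f' y = f y) →
        K.filter (· ∈ reachIn N K x f) = w → K.filter (· ∈ reachIn N K x f') = w := by
      intro w f f' h hw
      rw [reachIn_congr (f := f), hw]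
      intro y hy
      refine h y ?_
      rw [← hw, Finset.mem_filter]
      exact ⟨reachIn_subset (Finset.mem_coe.2 hx) f hy, hy⟩
    intro w _ i hi f z
    have hne : ∀ y ∈ w, Function.update f i z y = f y := fun y hy =>
      Function.update_of_ne (by rintro rfl; exact (Finset.mem_sdiff.1 hi).2 hy) _ _
    exact ⟨key w _ _ fun y hy => (hne y hy).symm, key w _ _ hne⟩
  have hpart : ∀ f : V → X, ∀ G : Finset V → ℝ≥0∞, G (K.filter (· ∈ reachIn N K x f)) =
      ∑ w ∈ K.powerset, {f : V → X | K.filter (· ∈ reachIn N K x f) = w}.indicator 1 f * G w := by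
    intro f G
    rw [Finset.sum_eq_single (K.filter (· ∈ reachIn N K x f))]
    · simp
    · intro w _ hw
      simp [Set.indicator, hw.symm]
    · intro h
      exact absurd (Finset.mem_powerset.2 (Finset.filter_subset _ _)) h
  calc ∫⁻ f, ∏ y ∈ K.filter (· ∈ reachIn N K x f), g y (f y) ∂Measure.infinitePi μ
      = ∑ w ∈ K.powerset, ∫⁻ f, {f : V → X | K.filter (· ∈ reachIn N K x f) = w}.indicator 1 f *
          ∏ y ∈ w, g y (f y) ∂Measure.infinitePi μ := by
        rw [← lintegral_finsetSum]
        · congr 1 with f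
          exact hpart f fun w => ∏ y ∈ w, g y (f y)
        · exact fun w _ => (measurable_one.indicator (hms w)).mul (hprod w)
    _ = ∑ w ∈ K.powerset, ∫⁻ f, {f : V → X | K.filter (· ∈ reachIn N K x f) = w}.indicator 1 f *
          ∏ y ∈ K, g y (f y) ∂Measure.infinitePi μ := by
        refine Finset.sum_congr rfl fun w hw => ?_
        have hwK := Finset.mem_powerset.1 hw
        -- On this event the unexplored weights are independent of everything used so far and have
        -- mean one, so they can be multiplied in for free. The product then runs over all of `K`,
        -- whatever `w` is.
        have := lintegral_mul_prod_coord μ (K \ w) (F := fun f =>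
          {f : V → X | K.filter (· ∈ reachIn N K x f) = w}.indicator 1 f * ∏ y ∈ w, g y (f y))
          ((measurable_one.indicator (hms w)).mul (hprod w)) ?_ hg hg1
        · rw [← this]
          congr 1 with f
          rw [mul_assoc, mul_comm (∏ y ∈ w, _), Finset.prod_sdiff hwK]
        · intro i hi f z
          congr 1
          · simp only [Set.indicator, Set.mem_ofPred_eq, hcongr w hwK i hi f z, Pi.one_apply]
          · refine Finset.prod_congr rfl fun y hy => ?_
            rw [Function.update_of_ne (by rintro rfl; exact (Finset.mem_sdiff.1 hi).2 hy)]
    _ = ∫⁻ f, 1 * ∏ y ∈ K, g y (f y) ∂Measure.infinitePi μ := by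
        rw [← lintegral_finsetSum]
        · congr 1 with f
          rw [one_mul]
          exact (hpart f fun _ => ∏ y ∈ K, g y (f y)).symm
        · exact fun w _ => (measurable_one.indicator (hms w)).mul (hprod K)
    _ = 1 := by
        rw [lintegral_mul_prod_coord μ K measurable_const (fun _ _ _ _ => rfl) hg hg1]
        simp

open Classical Filter in
/-- If the events `B y` are at least as likely as the events `A y`, up to a constant factor, and
infinitely many reachable sites `y` satisfy `A y`, then so many satisfy `B y`. -/
theorem ae_infinite_reachIn_of_le (hN : ∀ y w, MeasurableSet {z | w ∈ N y z})
    (μ : V → Measure X) [∀ i, IsProbabilityMeasure (μ i)] (x : V) {A B : V → Set X}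
    (hA : ∀ y, MeasurableSet (A y)) (hB : ∀ y, MeasurableSet (B y)) {h : ℝ≥0∞} (h0 : h ≠ 0)
    (hAB : ∀ y, h * μ y (A y) ≤ μ y (B y)) :
    ∀ᵐ f ∂Measure.infinitePi μ, {y | y ∈ reachIn N Set.univ x f ∧ f y ∈ A y}.Infinite →
      {y | y ∈ reachIn N Set.univ x f ∧ f y ∈ B y}.Infinite := by
  suffices H : ∀ F : Finset V, ∀ᵐ f ∂Measure.infinitePi μ,
      {y | y ∈ reachIn N Set.univ x f ∧ f y ∈ A y}.Infinite →
        ∃ y, y ∉ F ∧ y ∈ reachIn N Set.univ x f ∧ f y ∈ B y by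
    filter_upwards [ae_all_iff.2 H] with f hf hinf hfin
    obtain ⟨y, hy, hyB⟩ := hf hfin.toFinset hinf
    exact hy (hfin.mem_toFinset.2 hyB)
  intro F
  -- The weight `g₀ y` gains `h` on `A y` and pays for it by losing the fraction `s y` on `B y`,
  -- which keeps its mean equal to one; `hAB` ensures that there is enough mass to lose. Off `B y`
  -- it equals `1 + h` on `A y` and `1` elsewhere. Sites of `F` get weight one because nothing is
  -- known about `B` there.
  let s : V → ℝ≥0∞ := fun y => h * μ y (A y) / μ y (B y)
  let g₀ : V → X → ℝ≥0∞ := fun y z =>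
    (h * (A y).indicator 1 z + (1 - s y) * (B y).indicator 1 z) + (B y)ᶜ.indicator 1 z
  let g : V → X → ℝ≥0∞ := fun y => if y ∈ F then fun _ => 1 else g₀ y
  have hiA : ∀ y, Measurable fun z => h * (A y).indicator (1 : X → ℝ≥0∞) z := fun y =>
    (measurable_one.indicator (hA y)).const_mul _
  have hiB : ∀ y, Measurable fun z => (1 - s y) * (B y).indicator (1 : X → ℝ≥0∞) z := fun y =>
    (measurable_one.indicator (hB y)).const_mul _
  have hg₀ : ∀ y, Measurable (g₀ y) := fun y =>
    ((hiA y).add (hiB y)).add (measurable_one.indicator (hB y).compl)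
  have hg : ∀ y, Measurable (g y) := by
    intro y
    by_cases hy : y ∈ F
    · simp only [g, hy, if_true]; exact measurable_const
    · simp only [g, hy, if_false]; exact hg₀ y
  have hg₀1 : ∀ y, ∫⁻ z, g₀ y z ∂μ y = 1 := by
    intro y
    have hs : s y * μ y (B y) = h * μ y (A y) := by
      by_cases hb : μ y (B y) = 0
      · have := hAB y
        rw [hb] at this
        rw [hb, mul_zero, nonpos_iff_eq_zero.1 this]
      · exact ENNReal.div_mul_cancel hb (measure_ne_top _ _)
    have : ∫⁻ z, g₀ y z ∂μ y =
        (h * μ y (A y) + (1 - s y) * μ y (B y)) + μ y (B y)ᶜ := by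
      simp only [g₀]
      rw [lintegral_add_right _ (measurable_one.indicator (hB y).compl), lintegral_add_left (hiA y),
        lintegral_const_mul _ (measurable_one.indicator (hA y)),
        lintegral_const_mul _ (measurable_one.indicator (hB y)), lintegral_indicator_one (hA y),
        lintegral_indicator_one (hB y), lintegral_indicator_one (hB y).compl]
    rw [this, ENNReal.sub_mul (fun _ _ => measure_ne_top _ _), one_mul, hs,
      add_tsub_cancel_of_le (hAB y), prob_add_prob_compl (hB y)]
  have hg1 : ∀ y, ∫⁻ z, g y z ∂μ y = 1 := by
    intro y
    by_cases hy : y ∈ F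
    · simp [g, hy]
    · simp only [g, hy, if_false]; exact hg₀1 y
  -- The product identity concerns finite windows, so the exploration is confined to an exhausting
  -- sequence of them.
  obtain ⟨u, hu⟩ := exists_seq_tendsto (atTop : Filter (Finset V))
  let Z : ℕ → (V → X) → ℝ≥0∞ := fun n f =>
    ∏ y ∈ (insert x (u n)).filter (· ∈ reachIn N (insert x (u n) : Finset V) x f), g y (f y)
  have hZ : ∀ n, ∫⁻ f, Z n f ∂Measure.infinitePi μ = 1 := fun n =>
    lintegral_prod_reachIn hN μ (insert x (u n)) (Finset.mem_insert_self _ _) hg hg1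
  have hZm : ∀ n, Measurable (Z n) := by
    intro n
    have : Z n = fun f => ∏ y ∈ insert x (u n),
        if y ∈ reachIn N (insert x (u n) : Finset V) x f then g y (f y) else 1 := by
      funext f
      exact Finset.prod_filter _ _
    rw [this]
    refine Finset.measurable_prod _ fun y _ => ?_
    exact Measurable.ite (measurableSet_mem_reachIn hN _ x y)
      ((hg y).comp (measurable_pi_apply y)) measurable_const
  -- By Fatou the limit inferior of the products is almost surely finite. Infinitely many `A` and no
  -- `B` outside `F` would contradict this, since the products would then exceed every power of `1 +
  -- h`.
  have hlim : ∫⁻ f, liminf (fun n => Z n f) atTop ∂Measure.infinitePi μ ≠ ∞ := by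
    refine ne_top_of_le_ne_top ENNReal.one_ne_top ((lintegral_liminf_le hZm).trans ?_)
    simp [hZ]
  filter_upwards [ae_lt_top (Measurable.liminf hZm) hlim] with f hf hinf
  by_contra! hno
  refine hf.ne (top_unique ?_)
  have hinf' : ({y | y ∈ reachIn N Set.univ x f ∧ f y ∈ A y} \ (F : Set V)).Infinite :=
    hinf.sdiff F.finite_toSet
  have hge : ∀ k : ℕ, (1 + h) ^ k ≤ liminf (fun n => Z n f) atTop := by
    intro k
    obtain ⟨T, hT, hTk⟩ := hinf'.exists_subset_card_eq k
    have : ∀ y : V, ∃ G : Finset V, y ∈ T → y ∈ reachIn N G x f := by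
      intro y
      by_cases hy : y ∈ T
      · obtain ⟨G, hG⟩ := exists_finset_mem_reachIn (hT hy).1.1
        exact ⟨G, fun _ => hG⟩
      · exact ⟨∅, fun h => absurd h hy⟩
    choose G hG using this
    refine le_liminf_of_le (by isBoundedDefault) ?_
    -- The window must contain not only the `k` chosen sites but also finite paths leading to them.
    filter_upwards [hu.eventually (eventually_ge_atTop (T ∪ T.biUnion G))] with n hn
    have hsub : T ⊆ (insert x (u n)).filter
        (· ∈ reachIn N (insert x (u n) : Finset V) x f) := by
      intro y hy
      refine Finset.mem_filter.2 ⟨Finset.mem_insert_of_mem (hn (Finset.mem_union_left _ hy)), ?_⟩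
      refine reachIn_mono ?_ x f (hG y hy)
      intro z hz
      exact Finset.mem_insert_of_mem (hn (Finset.mem_union_right _
        (Finset.mem_biUnion.2 ⟨y, hy, hz⟩)))
    have hone : ∀ y, y ∉ F → y ∈ reachIn N Set.univ x f →
        g y (f y) = h * (A y).indicator 1 (f y) + 1 := by
      intro y hyF hy
      have hyB := hno y hyF hy
      simp [g, hyF, g₀, hyB]
    calc (1 + h) ^ k = ∏ y ∈ T, (1 + h) := by rw [Finset.prod_const, hTk]
      _ = ∏ y ∈ T, g y (f y) := by
        refine Finset.prod_congr rfl fun y hy => ?_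
        have := hT hy
        rw [hone y this.2 this.1.1, Set.indicator_of_mem this.1.2]
        simp [add_comm]
      _ ≤ Z n f := by
        refine Finset.prod_le_prod_of_subset_of_one_le' hsub fun y hy _ => ?_
        by_cases hyF : y ∈ F
        · simp [g, hyF]
        · rw [hone y hyF (reachIn_mono (Set.subset_univ _) x f (Finset.mem_filter.1 hy).2)]
          exact le_add_self
  have hpow : Tendsto (fun k : ℕ => (1 + h) ^ k) atTop (nhds ∞) :=
    ENNReal.tendsto_pow_atTop_nhds_top_iff.2 (ENNReal.lt_add_right ENNReal.one_ne_top h0)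
  exact le_of_tendsto' hpow hge

end Reach

/-! ### Frog processes as reachability in a directed graph -/

section Frogs

variable {V : Type*}

/-- Some frog from `y` is at `w` at a positive time. -/
def Wakes (n : V → ℕ) (s : ℕ → V → ℕ+ → V) (y w : V) : Prop :=
  ∃ i : ℕ+, (i : ℕ) ≤ n y ∧ ∃ j, s (j + 1) y i = w

/-- Times can be forgotten. A first visit always exhibits a waker with positive travel time.
Conversely, a frog woken at time `k` and travelling for time `j + 1` reaches its target at a time
when that site is either new or already visited. -/
theorem mem_visited_iff (n : V → ℕ) (s : ℕ → V → ℕ+ → V) (v w : V) :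
    w ∈ visited n s v ↔ Relation.ReflTransGen (Wakes n s) v w := by
  simp only [visited, Set.mem_iUnion]
  constructor
  · rintro ⟨j, hj⟩
    induction j using Nat.strong_induction_on generalizing w with
    | _ j ih =>
      cases j with
      | zero =>
        rw [firstVisited] at hj
        obtain rfl : w = v := hj
        exact Relation.ReflTransGen.refl
      | succ j =>
        rw [firstVisited] at hj
        obtain ⟨-, k, y, hy, i, hi, hs⟩ := hj
        refine (ih k.1 k.2 y hy).tail ⟨i, hi, j - k.1, ?_⟩
        rw [← hs]
        congr 1
        have := k.2
        omega
  · intro h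
    induction h with
    | refl => exact ⟨0, by rw [firstVisited]; exact rfl⟩
    | @tail y w _ hyw ih =>
      obtain ⟨k, hk⟩ := ih
      obtain ⟨i, hi, j, hj⟩ := hyw
      by_cases hw : ∃ m < k + j + 1, w ∈ firstVisited n s v m
      · obtain ⟨m, -, hm⟩ := hw
        exact ⟨m, hm⟩
      · push Not at hw
        refine ⟨k + j + 1, ?_⟩
        rw [firstVisited]
        refine ⟨fun m => hw m.1 m.2, ⟨k, by omega⟩, y, hk, i, hi, ?_⟩
        rw [← hj]
        congr 1
        simp only
        omega

theorem measurableSet_recurrent {Y : Type*} [MeasurableSpace Y] [Countable V]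
    [MeasurableSpace V] [MeasurableSingletonClass V]
    {n : Y → V → ℕ} (hn : Measurable n) {s : Y → ℕ → V → ℕ+ → V} (hs : Measurable s) (v : V) :
    MeasurableSet {y | Recurrent (n y) (s y) v} := by
  have hhit : ∀ j x i w, MeasurableSet {y | s y j x i = w} := by
    intro j x i w
    have : Measurable fun y => s y j x i := by fun_prop
    exact this (measurableSet_singleton w)
  have hnum : ∀ (i : ℕ+) x, MeasurableSet {y | (i : ℕ) ≤ n y x} := by
    intro i x
    have : Measurable fun y => n y x := by fun_prop
    exact measurableSet_le measurable_const this
  unfold Recurrent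
  refine measurableSet_setOf_infinite fun x => ?_
  simp only [mem_visited_iff]
  refine (measurableSet_reflTransGen (R := fun y => Wakes (n y) (s y)) ?_ v x).inter ?_
  · intro a b
    have : {y | Wakes (n y) (s y) a b} =
        ⋃ i : ℕ+, {y | (i : ℕ) ≤ n y a} ∩ ⋃ j, {y | s y (j + 1) a i = b} := by
      ext y
      simp [Wakes]
    rw [this]
    exact .iUnion fun i => (hnum i a).inter (.iUnion fun j => hhit _ _ _ _)
  · have : {y | ∃ i : ℕ+, (i : ℕ) ≤ n y x ∧ ∃ j : ℕ, s y j x i = v} =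
        ⋃ i : ℕ+, {y | (i : ℕ) ≤ n y x} ∩ ⋃ j, {y | s y j x i = v} := by
      ext y
      simp
    have h2 : MeasurableSet {y | ∃ i : ℕ+, (i : ℕ) ≤ n y x ∧ ∃ j : ℕ, s y j x i = v} := by
      rw [this]
      exact .iUnion fun i => (hnum i x).inter (.iUnion fun j => hhit _ _ _ _)
    exact h2

end Frogs

/-! ### Conductances under shifts -/

section Conductances

variable {d : ℕ}

theorem lattice_adj_add (x y z : Site d) : (lattice d).Adj (x + z) (y + z) ↔
    (lattice d).Adj x y := by
  show ∑ i, |(x + z) i - (y + z) i| = 1 ↔ ∑ i, |x i - y i| = 1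
  simp

theorem conductance_shiftEnv (z : Site d) (c : Env d) (x y : Site d) :
    conductance (shiftEnv z c) x y = conductance c (x + z) (y + z) := by
  by_cases h : (lattice d).Adj x y
  · rw [conductance, conductance, dif_pos h, dif_pos ((lattice_adj_add x y z).2 h)]
    rfl
  · rw [conductance, conductance, dif_neg h, dif_neg (mt (lattice_adj_add x y z).1 h)]

theorem conductance_comm (c : Env d) (x y : Site d) : conductance c x y = conductance c y x := by
  by_cases h : (lattice d).Adj x y
  · rw [conductance, conductance, dif_pos h, dif_pos h.symm]
    congr 2
    exact Sym2.eq_swap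
  · rw [conductance, conductance, dif_neg h, dif_neg fun h' => h h'.symm]

theorem conductance_eq_zero_of_notMem (c : Env d) {x y : Site d} (h : y ∉ neighbors x) :
    conductance c x y = 0 := by
  rw [conductance, dif_neg (mt (mem_neighbors x y).2 h)]

theorem self_notMem_neighbors (x : Site d) : x ∉ neighbors x := by
  rw [mem_neighbors]
  exact (lattice d).loopless.irrefl x

theorem add_mem_neighbors_add (x y z : Site d) : y + z ∈ neighbors (x + z) ↔
    y ∈ neighbors x := by
  rw [mem_neighbors, mem_neighbors, lattice_adj_add]

theorem sum_neighbors_add {M : Type*} [AddCommMonoid M] (x z : Site d) (f : Site d → M) :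
    ∑ y ∈ neighbors (x + z), f y = ∑ y ∈ neighbors x, f (y + z) := by
  refine (Finset.sum_bij (fun y _ => y + z) ?_ ?_ ?_ ?_).symm
  · intro y hy
    exact (add_mem_neighbors_add x y z).2 hy
  · intro a _ b _ h
    exact add_right_cancel h
  · intro b hb
    refine ⟨b - z, (add_mem_neighbors_add x _ z).1 (by simpa using hb), by simp⟩
  · intro a _
    rfl

theorem sum_neighbors_zero_neg {M : Type*} [AddCommMonoid M] (f : Site d → M) :
    ∑ y ∈ neighbors 0, f (-y) = ∑ y ∈ neighbors 0, f y := by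
  have key : ∀ y : Site d, y ∈ neighbors 0 → -y ∈ neighbors 0 := by
    intro y hy
    rw [mem_neighbors] at hy ⊢
    have := (lattice_adj_add 0 (-y) y).1 (by simpa using hy.symm)
    exact this
  exact Finset.sum_bij' (fun y _ => -y) (fun y _ => -y) key key (by simp) (by simp) (by simp)

theorem totalConductance_shiftEnv (z : Site d) (c : Env d) (x : Site d) :
    totalConductance (shiftEnv z c) x = totalConductance c (x + z) := by
  rw [totalConductance, totalConductance, sum_neighbors_add]
  exact Finset.sum_congr rfl fun y _ => conductance_shiftEnv z c x y

theorem transition_shiftEnv (z : Site d) (c : Env d) (x y : Site d) :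
    transition (shiftEnv z c) x y = transition c (x + z) (y + z) := by
  simp only [transition, totalConductance_shiftEnv, conductance_shiftEnv, add_left_inj]

theorem shiftEnv_shiftEnv (y z : Site d) (c : Env d) :
    shiftEnv y (shiftEnv z c) = shiftEnv (y + z) c := by
  funext e
  rw [shiftEnv, shiftEnv, shiftEnv]
  congr 1
  obtain ⟨e, he⟩ := e
  induction e with
  | _ a b =>
    apply Subtype.ext
    show s(a + y + z, b + y + z) = s(a + (y + z), b + (y + z))
    rw [add_assoc, add_assoc]

theorem cluster_eq_of_mem {c : Env d} {x y : Site d} (h : y ∈ cluster c x) :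
    cluster c y = cluster c x := by
  have hsymm : x ∈ cluster c y := by
    have : ∀ {a b}, Relation.ReflTransGen (fun u v => 0 < conductance c u v) a b →
        Relation.ReflTransGen (fun u v => 0 < conductance c u v) b a := by
      intro a b hab
      induction hab with
      | refl => exact .refl
      | tail _ h ih => exact .head (by rwa [conductance_comm]) ih
    exact this h
  ext w
  exact ⟨fun hw => Relation.ReflTransGen.trans h hw, fun hw => Relation.ReflTransGen.trans hsymm hw⟩

theorem measurable_shiftEnv (z : Site d) : Measurable (shiftEnv (d := d) z) :=
  measurable_pi_lambda _ fun _ => measurable_pi_apply _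

@[fun_prop]
theorem measurable_conductance (x y : Site d) : Measurable fun c : Env d => conductance c x y := by
  by_cases h : (lattice d).Adj x y
  · simp only [conductance, dif_pos h]
    exact measurable_pi_apply _
  · simp only [conductance, dif_neg h]
    exact measurable_const

@[fun_prop]
theorem measurable_totalConductance (x : Site d) :
    Measurable fun c : Env d => totalConductance c x :=
  Finset.measurable_sum _ fun y _ => measurable_conductance x y

@[fun_prop]
theorem measurable_transition (x y : Site d) : Measurable fun c : Env d => transition c x y := by
  unfold transition
  refine Measurable.ite ?_ measurable_const (by fun_prop)
  exact measurable_totalConductance x (measurableSet_singleton 0)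

theorem measurableSet_mem_cluster (x y : Site d) :
    MeasurableSet {c : Env d | y ∈ cluster c x} :=
  measurableSet_reflTransGen (R := fun c u v => 0 < conductance c u v)
    (fun a b => measurableSet_lt measurable_const (measurable_conductance a b)) x y

theorem measurableSet_cluster_infinite (x : Site d) :
    MeasurableSet {c : Env d | (cluster c x).Infinite} :=
  measurableSet_setOf_infinite fun y => measurableSet_mem_cluster x y

theorem transition_nonneg (c : Env d) (x y : Site d) : 0 ≤ transition c x y := by
  unfold transition
  split_ifs <;> positivity

theorem transition_eq_zero (c : Env d) {x y : Site d} (hxy : y ≠ x) (h : conductance c x y = 0) :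
    transition c x y = 0 := by
  simp [transition, hxy, h]

theorem transition_pos (c : Env d) {x y : Site d} (h : 0 < conductance c x y) :
    0 < transition c x y := by
  have hy : y ∈ neighbors x := by
    by_contra hy
    exact h.ne' (conductance_eq_zero_of_notMem c hy)
  have : 0 < totalConductance c x :=
    h.trans_le (Finset.single_le_sum (f := fun y => conductance c x y)
      (fun _ _ => zero_le) hy)
  rw [transition, if_neg this.ne']
  exact div_pos (by exact_mod_cast h) (by exact_mod_cast this)

open Classical in
theorem sum_transition (c : Env d) (x : Site d) :
    ∑ y ∈ insert x (neighbors x), transition c x y = 1 := by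
  rw [Finset.sum_insert (self_notMem_neighbors x)]
  by_cases h : totalConductance c x = 0
  · rw [Finset.sum_eq_zero]
    · simp [transition, h]
    · intro y hy
      have : y ≠ x := by rintro rfl; exact self_notMem_neighbors y hy
      simp [transition, h, this]
  · simp only [transition, h, if_false]
    rw [conductance_eq_zero_of_notMem c (self_notMem_neighbors x), NNReal.coe_zero, zero_div,
      zero_add, ← Finset.sum_div, ← NNReal.coe_sum]
    exact div_self (by exact_mod_cast h)

theorem totalConductance_mul_transition (c : Env d) (x y : Site d) :
    (totalConductance c x : ℝ) * transition c x y = conductance c x y := by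
  by_cases h : totalConductance c x = 0
  · have hc : conductance c x y = 0 := by
      by_cases hy : y ∈ neighbors x
      · exact (Finset.sum_eq_zero_iff.1 h) y hy
      · exact conductance_eq_zero_of_notMem c hy
    simp [h, hc]
  · rw [transition, if_neg h]
    field_simp

end Conductances

/-! ### Random walks driven by uniform random variables -/

section Walk

variable {d : ℕ}

open Classical in
/-- The law of the first step of the walk from the origin. -/
def stepKernel (d : ℕ) : Kernel (Env d) (Site d) where
  toFun c := ∑ z ∈ insert 0 (neighbors 0), ENNReal.ofReal (transition c 0 z) • Measure.dirac z
  measurable' := by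
    refine Measure.measurable_of_measurable_coe _ fun s hs => ?_
    simp only [Measure.coe_finsetSum, Finset.sum_apply, Measure.smul_apply, smul_eq_mul]
    refine Finset.measurable_sum _ fun z _ => ?_
    fun_prop

theorem stepKernel_singleton (c : Env d) (z : Site d) :
    stepKernel d c {z} = ENNReal.ofReal (transition c 0 z) := by
  classical
  show (∑ y ∈ insert 0 (neighbors 0), ENNReal.ofReal (transition c 0 y) • Measure.dirac y)
    ({z} : Set (Site d)) = _
  simp only [Measure.coe_finsetSum, Finset.sum_apply, Measure.smul_apply, smul_eq_mul,
    Measure.dirac_apply, Set.indicator, Set.mem_singleton_iff, Pi.one_apply, mul_ite, mul_one,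
    mul_zero]
  rw [Finset.sum_ite_eq']
  split_ifs with h
  · rfl
  · rw [Finset.mem_insert, not_or] at h
    rw [transition_eq_zero c h.1 (conductance_eq_zero_of_notMem c h.2), ENNReal.ofReal_zero]

instance : IsMarkovKernel (stepKernel d) := by
  classical
  refine ⟨fun c => ⟨?_⟩⟩
  show (∑ y ∈ insert 0 (neighbors 0), ENNReal.ofReal (transition c 0 y) • Measure.dirac y)
    (Set.univ : Set (Site d)) = _
  simp only [Measure.coe_finsetSum, Finset.sum_apply, Measure.smul_apply, smul_eq_mul,
    measure_univ, mul_one]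
  rw [← ENNReal.ofReal_sum_of_nonneg fun y _ => transition_nonneg c 0 y, sum_transition,
    ENNReal.ofReal_one]

/-- A Markov kernel on a countable space can be sampled from one uniform variable, measurably in the
environment. The sampled map is altered on a null set so that jumps along edges of zero conductance
never occur. Walks then stay in their cluster surely, not merely almost surely. -/
theorem exists_increment (d : ℕ) : ∃ f : Env d → unitInterval → Site d,
    Measurable (Function.uncurry f) ∧
    (∀ c z, volume {u | f c u = z} = ENNReal.ofReal (transition c 0 z)) ∧
    ∀ c u, f c u = 0 ∨ 0 < conductance c 0 (f c u) := by
  classical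
  obtain ⟨f, hf, hlaw⟩ := (stepKernel d).exists_measurable_map_eq_unitInterval
  have hfc : ∀ c, Measurable (f c) := fun c => hf.of_uncurry_left
  have hvol : ∀ c z, volume {u | f c u = z} = ENNReal.ofReal (transition c 0 z) := by
    intro c z
    rw [← stepKernel_singleton, ← hlaw c, Measure.map_apply (hfc c) (measurableSet_singleton z)]
    rfl
  refine ⟨fun c u => if 0 < conductance c 0 (f c u) then f c u else 0, ?_, ?_, ?_⟩
  · have hset : MeasurableSet {p : Env d × unitInterval | 0 < conductance p.1 0 (f p.1 p.2)} := by
      have : {p : Env d × unitInterval | 0 < conductance p.1 0 (f p.1 p.2)} =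
          ⋃ z, {p | f p.1 p.2 = z} ∩ {p | 0 < conductance p.1 0 z} := by
        ext p
        simp
      rw [this]
      refine .iUnion fun z => (hf (measurableSet_singleton z)).inter ?_
      exact measurableSet_lt measurable_const ((measurable_conductance 0 z).comp measurable_fst)
    exact Measurable.ite hset hf measurable_const
  · intro c z
    rw [← hvol c z]
    apply measure_congr
    have hnull : ∀ᵐ u : unitInterval, f c u = 0 ∨ 0 < conductance c 0 (f c u) := by
      have : ∀ z : Site d, ∀ᵐ u : unitInterval, f c u = z → z = 0 ∨ 0 < conductance c 0 z := by
        intro z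
        by_cases hz : z = 0 ∨ 0 < conductance c 0 z
        · exact ae_of_all _ fun _ _ => hz
        · rw [not_or, not_lt] at hz
          have h0 := hvol c z
          rw [transition_eq_zero c hz.1 (nonpos_iff_eq_zero.1 hz.2), ENNReal.ofReal_zero] at h0
          have : ∀ᵐ u : unitInterval, ¬ f c u = z := by
            rw [ae_iff]
            simpa using h0
          filter_upwards [this] with u hu h
          exact absurd h hu
      filter_upwards [ae_all_iff.2 this] with u hu
      exact hu _ rfl
    filter_upwards [hnull] with u hu
    have : (if 0 < conductance c 0 (f c u) then f c u else 0) = f c u := by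
      split_ifs with h
      · rfl
      · exact (hu.resolve_right h).symm
    show ((if 0 < conductance c 0 (f c u) then f c u else 0) = z) = (f c u = z)
    rw [this]
  · intro c u
    dsimp only
    split_ifs with h
    · exact .inr h
    · exact .inl rfl

/-- A measurable function producing the first step of the walk from a uniform variable. -/
def increment (c : Env d) (u : unitInterval) : Site d := (exists_increment d).choose c u

theorem measurable_increment : Measurable (Function.uncurry (increment (d := d))) :=
  (exists_increment d).choose_spec.1

/-- The site to which the walk moves from `y` when the uniform variable is `u`. -/
def step (c : Env d) (y : Site d) (u : unitInterval) : Site d := y + increment (shiftEnv y c) u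

theorem volume_step_eq (c : Env d) (y z : Site d) :
    volume {u | step c y u = z} = ENNReal.ofReal (transition c y z) := by
  have h := (exists_increment d).choose_spec.2.1 (shiftEnv y c) (z - y)
  rw [transition_shiftEnv, zero_add, sub_add_cancel] at h
  rw [← h]
  congr 1 with u
  show y + increment (shiftEnv y c) u = z ↔ increment (shiftEnv y c) u = z - y
  rw [eq_sub_iff_add_eq, add_comm]

theorem step_eq_or (c : Env d) (y : Site d) (u : unitInterval) :
    step c y u = y ∨ 0 < conductance c y (step c y u) := by
  rcases (exists_increment d).choose_spec.2.2 (shiftEnv y c) u with h | h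
  · left
    show y + increment (shiftEnv y c) u = y
    rw [increment, h, add_zero]
  · right
    rw [conductance_shiftEnv, zero_add, add_comm] at h
    exact h

/-- The increment depends only on the environment seen from the walker, so equivariance holds
pointwise. This is what later makes recurrence an exactly shift-covariant event. -/
theorem step_shiftEnv (z : Site d) (c : Env d) (y : Site d) (u : unitInterval) :
    step (shiftEnv z c) y u + z = step c (y + z) u := by
  rw [step, step, shiftEnv_shiftEnv]
  abel

/-- The walk from `x` among the conductances `c` driven by the uniform variables `u`. -/
def walk (c : Env d) (x : Site d) (u : ℕ → unitInterval) : ℕ → Site d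
  | 0 => x
  | j + 1 => step c (walk c x u j) (u j)

theorem walk_shiftEnv (z : Site d) (c : Env d) (x : Site d) (u : ℕ → unitInterval) (j : ℕ) :
    walk (shiftEnv z c) x u j + z = walk c (x + z) u j := by
  induction j with
  | zero => rfl
  | succ j ih => rw [walk, walk, step_shiftEnv, ih]

theorem walk_mem_cluster (c : Env d) (x : Site d) (u : ℕ → unitInterval) (j : ℕ) :
    walk c x u j ∈ cluster c x := by
  induction j with
  | zero => exact Relation.ReflTransGen.refl
  | succ j ih =>
    rw [walk]
    rcases step_eq_or c (walk c x u j) (u j) with h | h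
    · rw [h]; exact ih
    · exact Relation.ReflTransGen.tail ih h

theorem walk_congr (c : Env d) (x : Site d) {u u' : ℕ → unitInterval} {j : ℕ}
    (h : ∀ k < j, u k = u' k) : walk c x u j = walk c x u' j := by
  induction j with
  | zero => rfl
  | succ j ih => rw [walk, walk, ih fun k hk => h k (by omega), h j (by omega)]

theorem walk_succ' (c : Env d) (x : Site d) (u : ℕ → unitInterval) (j : ℕ) :
    walk c x u (j + 1) = walk c (step c x (u 0)) (fun k => u (k + 1)) j := by
  induction j with
  | zero => rfl
  | succ j ih => rw [walk, ih, walk]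

theorem measurable_step : Measurable fun p : (Env d × unitInterval) × Site d =>
    step p.1.1 p.2 p.1.2 := by
  refine measurable_from_prod_countable_left fun y => ?_
  have : Measurable fun p : Env d × unitInterval => increment (shiftEnv y p.1) p.2 :=
    measurable_increment.comp
      (((measurable_shiftEnv y).comp measurable_fst).prodMk measurable_snd)
  exact this.const_add y

theorem measurable_walk (x : Site d) (j : ℕ) :
    Measurable fun p : Env d × (ℕ → unitInterval) => walk p.1 x p.2 j := by
  induction j with
  | zero => exact measurable_const
  | succ j ih =>
    have h1 : Measurable fun p : Env d × (ℕ → unitInterval) => (p.1, p.2 j) := by fun_prop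
    exact measurable_step.comp (h1.prodMk ih)

/-- The joint law of the walk at the times `0, …, m`. -/
theorem infinitePi_walk_eq (c : Env d) (x : Site d) (m : ℕ) (p : ℕ → Site d) :
    Measure.infinitePi (fun _ : ℕ => (volume : Measure unitInterval))
      {u | ∀ j ≤ m, walk c x u j = p j} =
    (if p 0 = x then 1 else 0) *
      ∏ j ∈ Finset.range m, ENNReal.ofReal (transition c (p j) (p (j + 1))) := by
  by_cases h0 : p 0 = x
  · have : {u : ℕ → unitInterval | ∀ j ≤ m, walk c x u j = p j} =
        Set.pi (Finset.range m) fun j => {v | step c (p j) v = p (j + 1)} := by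
      ext u
      simp only [Set.mem_ofPred_eq, Set.mem_pi, Finset.mem_coe, Finset.mem_range]
      constructor
      · intro h j hj
        rw [← h j hj.le, ← h (j + 1) hj, walk]
      · intro h j
        induction j with
        | zero => intro _; rw [walk, h0]
        | succ j ih =>
          intro hj
          rw [walk, ih (by omega), h j hj]
    rw [this, Measure.infinitePi_pi, if_pos h0, one_mul]
    · exact Finset.prod_congr rfl fun j _ => volume_step_eq c (p j) (p (j + 1))
    · intro j _
      have hm : Measurable fun v => step c (p j) v :=
        measurable_step.comp ((measurable_const.prodMk measurable_id).prodMk measurable_const)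
      exact hm (measurableSet_singleton _)
  · rw [if_neg h0, zero_mul]
    have : {u : ℕ → unitInterval | ∀ j ≤ m, walk c x u j = p j} = ∅ := by
      ext u
      simp only [Set.mem_ofPred_eq, Set.mem_empty_iff_false, iff_false]
      intro h
      exact h0 (h 0 (Nat.zero_le _)).symm
    rw [this, measure_empty]

end Walk

/-! ### Frogs driven by uniform random variables -/

section CanonicalFrogs

variable {d : ℕ}

/-- The randomness attached to a site: the number of frogs and the uniform variables `(i, k)` that
drive the `k`-th step of the `i`-th frog. -/
abbrev Noise : Type := ℕ × (ℕ+ × ℕ → unitInterval)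

/-- The law of the randomness at a site if the number of frogs has law `τ`. -/
def noiseLaw (τ : Measure ℕ) : Measure Noise :=
  τ.prod (Measure.infinitePi fun _ : ℕ+ × ℕ => (volume : Measure unitInterval))

instance (τ : Measure ℕ) [IsProbabilityMeasure τ] : IsProbabilityMeasure (noiseLaw τ) := by
  unfold noiseLaw
  infer_instance

/-- The number of frogs at each site. -/
def frogCount (ξ : Site d → Noise) (x : Site d) : ℕ := (ξ x).1

/-- The frog trajectories among the conductances `c`. -/
def frogPath (c : Env d) (ξ : Site d → Noise) (j : ℕ) (x : Site d) (i : ℕ+) : Site d :=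
  walk c x (fun k => (ξ x).2 (i, k)) j

/-- The sites visited at a positive time by the frogs from `y`. -/
def wakeSet (c : Env d) (y : Site d) (z : Noise) : Set (Site d) :=
  {w | ∃ i : ℕ+, (i : ℕ) ≤ z.1 ∧ ∃ j, walk c y (fun k => z.2 (i, k)) (j + 1) = w}

/-- The event that some frog from `y` visits `w`. -/
def visitEvent (c : Env d) (y w : Site d) : Set Noise :=
  {z | ∃ i : ℕ+, (i : ℕ) ≤ z.1 ∧ ∃ j, walk c y (fun k => z.2 (i, k)) j = w}

/-- The sites visited in the frog process started from `x`. -/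
def range (c : Env d) (ξ : Site d → Noise) (x : Site d) : Set (Site d) :=
  reachIn (wakeSet c) Set.univ x ξ

/-- The sites in the range of the process from `x` whose frogs visit `v`. -/
def visitors (c : Env d) (ξ : Site d → Noise) (x v : Site d) : Set (Site d) :=
  {y | y ∈ range c ξ x ∧ ξ y ∈ visitEvent c y v}

/-- Recurrence of the site `v` for the frogs given by `c` and `ξ`. -/
def Rec (c : Env d) (ξ : Site d → Noise) (v : Site d) : Prop :=
  Recurrent (frogCount ξ) (frogPath c ξ) v

theorem mem_range_iff (c : Env d) (ξ : Site d → Noise) (x w : Site d) :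
    w ∈ range c ξ x ↔ Relation.ReflTransGen (Wakes (frogCount ξ) (frogPath c ξ)) x w := by
  simp only [range, reachIn, Set.mem_ofPred_eq, Set.mem_univ, true_and]
  rfl

theorem rec_iff (c : Env d) (ξ : Site d → Noise) (v : Site d) :
    Rec c ξ v ↔ (visitors c ξ v v).Infinite := by
  rw [Rec, Recurrent, visitors]
  simp only [mem_visited_iff, mem_range_iff]
  rfl

theorem measurable_noise_walk (y : Site d) (i : ℕ+) (j : ℕ) :
    Measurable fun p : Env d × Noise => walk p.1 y (fun k => p.2.2 (i, k)) j := by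
  have : Measurable fun p : Env d × Noise => (p.1, fun k : ℕ => p.2.2 (i, k)) := by fun_prop
  exact (measurable_walk y j).comp this

theorem measurableSet_visit (y w : Site d) :
    MeasurableSet {p : Env d × Noise | p.2 ∈ visitEvent p.1 y w} := by
  have : {p : Env d × Noise | p.2 ∈ visitEvent p.1 y w} = ⋃ i : ℕ+,
      {p : Env d × Noise | (i : ℕ) ≤ p.2.1} ∩
        ⋃ j, {p | walk p.1 y (fun k => p.2.2 (i, k)) j = w} := by
    ext p
    simp [visitEvent]
  rw [this]
  refine .iUnion fun i => .inter ?_ (.iUnion fun j => ?_)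
  · exact measurableSet_le measurable_const (by fun_prop)
  · exact measurable_noise_walk y i j (measurableSet_singleton w)

theorem measurableSet_visitEvent (c : Env d) (y w : Site d) : MeasurableSet (visitEvent c y w) :=
  (measurable_prodMk_left : Measurable fun z : Noise => (c, z)) (measurableSet_visit y w)

theorem measurableSet_wake (y w : Site d) :
    MeasurableSet {p : Env d × Noise | w ∈ wakeSet p.1 y p.2} := by
  have : {p : Env d × Noise | w ∈ wakeSet p.1 y p.2} = ⋃ i : ℕ+,
      {p : Env d × Noise | (i : ℕ) ≤ p.2.1} ∩
        ⋃ j, {p | walk p.1 y (fun k => p.2.2 (i, k)) (j + 1) = w} := by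
    ext p
    simp [wakeSet]
  rw [this]
  refine .iUnion fun i => .inter ?_ (.iUnion fun j => ?_)
  · exact measurableSet_le measurable_const (by fun_prop)
  · exact measurable_noise_walk y i (j + 1) (measurableSet_singleton w)

theorem measurableSet_mem_wakeSet (c : Env d) (y w : Site d) :
    MeasurableSet {z | w ∈ wakeSet c y z} :=
  (measurable_prodMk_left : Measurable fun z : Noise => (c, z)) (measurableSet_wake y w)

/-- The frogs from `y` that visit `v` step to `w` with at least the transition probability. -/
theorem transition_mul_visit_le (c : Env d) (y v w : Site d) (n : ℕ) :
    ENNReal.ofReal (transition c v w) *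
      Measure.infinitePi (fun _ : ℕ+ × ℕ => (volume : Measure unitInterval))
        {U | (n, U) ∈ visitEvent c y v} ≤
      Measure.infinitePi (fun _ : ℕ+ × ℕ => (volume : Measure unitInterval))
        {U | (n, U) ∈ visitEvent c y w} := by
  classical
  let at_ : ℕ+ × ℕ → Set (ℕ+ × ℕ → unitInterval) := fun q =>
    {U | (q.1 : ℕ) ≤ n ∧ walk c y (fun k => U (q.1, k)) q.2 = v}
  -- `D (i, j)` says that `(i, j)` is the lexicographically first pair such that frog `i` is at `v`
  -- at time `j`. The lexicographic order matters: the event reads only frogs with smaller index and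
  -- the past of frog `i`, never `U (i, j)`, which drives the next step.
  let D : ℕ+ × ℕ → Set (ℕ+ × ℕ → unitInterval) := fun q =>
    {U | U ∈ at_ q ∧ ∀ r, toLex r < toLex q → U ∉ at_ r}
  let G : ℕ+ × ℕ → Set (ℕ+ × ℕ → unitInterval) := fun q =>
    D q ∩ {U | U q ∈ {u | step c v u = w}}
  have hwm : ∀ q : ℕ+ × ℕ, Measurable fun U : ℕ+ × ℕ → unitInterval =>
      walk c y (fun k => U (q.1, k)) q.2 := by
    intro q
    have : Measurable fun U : ℕ+ × ℕ → unitInterval => (c, fun k : ℕ => U (q.1, k)) := by fun_prop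
    exact (measurable_walk y q.2).comp this
  have hat : ∀ q, MeasurableSet (at_ q) := fun q =>
    (MeasurableSet.const _).inter (hwm q (measurableSet_singleton v))
  have hD : ∀ q, MeasurableSet (D q) := by
    intro q
    have : D q = at_ q ∩ ⋂ r, ⋂ (_ : toLex r < toLex q), (at_ r)ᶜ := by
      ext U
      simp [D]
    rw [this]
    exact (hat q).inter (.iInter fun r => .iInter fun _ => (hat r).compl)
  have hstep : MeasurableSet {u : unitInterval | step c v u = w} := by
    have hm : Measurable fun u => step c v u :=
      measurable_step.comp ((measurable_const.prodMk measurable_id).prodMk measurable_const)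
    exact hm (measurableSet_singleton w)
  have hG : ∀ q, MeasurableSet (G q) := fun q =>
    (hD q).inter ((measurable_pi_apply q : Measurable fun U : ℕ+ × ℕ → unitInterval => U q) hstep)
  have hdisj : Pairwise (Function.onFun Disjoint D) := by
    intro q r hqr
    rw [Function.onFun, Set.disjoint_left]
    intro U hq hr
    rcases lt_or_gt_of_ne (a := toLex q) (b := toLex r) (by simpa using hqr) with h | h
    · exact hr.2 q h hq.1
    · exact hq.2 r h hr.1
  have hinv_at : ∀ q r, r = q ∨ toLex r < toLex q → ∀ (U : ℕ+ × ℕ → unitInterval) u,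
      (Function.update U q u ∈ at_ r ↔ U ∈ at_ r) := by
    intro q r hrq U u
    have : walk c y (fun k => Function.update U q u (r.1, k)) r.2 =
        walk c y (fun k => U (r.1, k)) r.2 := by
      apply walk_congr
      intro k hk
      refine Function.update_of_ne ?_ _ _
      rintro rfl
      rcases hrq with h | h
      · rw [h] at hk
        exact lt_irrefl _ hk
      · rw [Prod.Lex.toLex_lt_toLex] at h
        rcases h with h | h
        · exact lt_irrefl _ h
        · exact lt_asymm hk h.2
    show ((r.1 : ℕ) ≤ n ∧ _ = v) ↔ ((r.1 : ℕ) ≤ n ∧ _ = v)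
    rw [this]
  have hinv : ∀ q (U : ℕ+ × ℕ → unitInterval) u, Function.update U q u ∈ D q ↔ U ∈ D q := by
    intro q U u
    refine and_congr (hinv_at q q (.inl rfl) U u) (forall₂_congr fun r hr => ?_)
    rw [hinv_at q r (.inr hr) U u]
  have hunion : {U | (n, U) ∈ visitEvent c y v} = ⋃ q, D q := by
    ext U
    simp only [Set.mem_iUnion]
    constructor
    · rintro ⟨i, hi, j, hj⟩
      obtain ⟨q, hq, hmin⟩ := (wellFounded_lt (α := ℕ+ ×ₗ ℕ)).has_min
        {q | U ∈ at_ (ofLex q)} ⟨toLex (i, j), hi, hj⟩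
      exact ⟨ofLex q, hq, fun r hr hU => hmin (toLex r) hU hr⟩
    · rintro ⟨q, hq, -⟩
      exact ⟨q.1, hq.1, q.2, hq.2⟩
  have hGsub : (⋃ q, G q) ⊆ {U | (n, U) ∈ visitEvent c y w} := by
    intro U hU
    obtain ⟨q, hq, hs⟩ := Set.mem_iUnion.1 hU
    refine ⟨q.1, hq.1.1, q.2 + 1, ?_⟩
    rw [walk]
    show step c (walk c y (fun k => U (q.1, k)) q.2) (U q) = w
    rw [hq.1.2]
    exact hs
  rw [hunion, measure_iUnion hdisj hD, ← ENNReal.tsum_mul_left]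
  refine le_trans ?_ (measure_mono hGsub)
  rw [measure_iUnion (fun q r h => (hdisj h).mono Set.inter_subset_left Set.inter_subset_left) hG]
  refine ENNReal.tsum_le_tsum fun q => ?_
  rw [measure_inter_coord _ q (hD q) (hinv q) hstep, volume_step_eq, mul_comm]

theorem noiseLaw_apply (τ : Measure ℕ) {s : Set Noise} (hs : MeasurableSet s) :
    noiseLaw τ s = ∫⁻ n, Measure.infinitePi (fun _ : ℕ+ × ℕ => (volume : Measure unitInterval))
      {U | (n, U) ∈ s} ∂τ := by
  rw [noiseLaw, Measure.prod_apply hs]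
  rfl

/-- The constant is the product of the transition probabilities along a path of positive
conductances from `v` to `w`; the point is that it does not depend on the starting site `y`. -/
theorem exists_visit_comparison (τ : Measure ℕ) {c : Env d} {v w : Site d} (h : w ∈ cluster c v) :
    ∃ p : ℝ≥0∞, p ≠ 0 ∧
      ∀ y, p * noiseLaw τ (visitEvent c y v) ≤ noiseLaw τ (visitEvent c y w) := by
  induction h with
  | refl => exact ⟨1, one_ne_zero, fun y => by rw [one_mul]⟩
  | @tail a b _ hab ih =>
    obtain ⟨p, hp, hle⟩ := ih
    refine ⟨ENNReal.ofReal (transition c a b) * p, mul_ne_zero ?_ hp, fun y => ?_⟩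
    · exact (ENNReal.ofReal_pos.2 (transition_pos c hab)).ne'
    · rw [mul_assoc]
      refine (mul_le_mul_right (hle y) _).trans ?_
      rw [noiseLaw_apply τ (measurableSet_visitEvent c y a),
        noiseLaw_apply τ (measurableSet_visitEvent c y b), ← lintegral_const_mul' _ _ (by simp)]
      exact lintegral_mono fun n => transition_mul_visit_le c y a b n

/-- Almost surely, a process with infinitely many visitors at `v` has infinitely many visitors at
every site of the cluster of `v`. -/
theorem ae_visitors_infinite (τ : Measure ℕ) [IsProbabilityMeasure τ] (c : Env d) :
    ∀ᵐ ξ ∂Measure.infinitePi (fun _ : Site d => noiseLaw τ), ∀ x v w, w ∈ cluster c v →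
      (visitors c ξ x v).Infinite → (visitors c ξ x w).Infinite := by
  simp only [ae_all_iff]
  intro x v w hw
  obtain ⟨p, hp, hle⟩ := exists_visit_comparison τ hw
  exact ae_infinite_reachIn_of_le (measurableSet_mem_wakeSet c) (fun _ => noiseLaw τ) x
    (measurableSet_visitEvent c · v) (measurableSet_visitEvent c · w) hp hle

end CanonicalFrogs

/-! ### The joint law of conductances and frogs, and its shifts -/

section Model

variable {d : ℕ}

/-- Conductances together with the randomness of the frogs. -/
abbrev Model (d : ℕ) : Type := Env d × (Site d → Noise)

/-- The law of the randomness of all frogs. -/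
def noiseField (d : ℕ) (τ : Measure ℕ) [IsProbabilityMeasure τ] : Measure (Site d → Noise) :=
  Measure.infinitePi fun _ : Site d => noiseLaw τ

instance (τ : Measure ℕ) [IsProbabilityMeasure τ] : IsProbabilityMeasure (noiseField d τ) := by
  unfold noiseField
  infer_instance

/-- Conductances of law `ν` with independent frogs. -/
def modelLaw (ν : Measure (Env d)) (τ : Measure ℕ) [IsProbabilityMeasure τ] :
    Measure (Model d) :=
  ν.prod (noiseField d τ)

instance (ν : Measure (Env d)) [IsProbabilityMeasure ν] (τ : Measure ℕ) [IsProbabilityMeasure τ] :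
    IsProbabilityMeasure (modelLaw ν τ) := by
  unfold modelLaw
  infer_instance

/-- The shift of the model by `z`. -/
def shiftModel (z : Site d) (ω : Model d) : Model d := (shiftEnv z ω.1, fun x => ω.2 (x + z))

theorem measurePreserving_shiftNoise (τ : Measure ℕ) [IsProbabilityMeasure τ] (z : Site d) :
    MeasurePreserving (fun ξ : Site d → Noise => fun x => ξ (x + z)) (noiseField d τ)
      (noiseField d τ) :=
  ⟨by fun_prop, Measure.map_infinitePi_infinitePi_of_inj (P := fun _ : Site d => noiseLaw τ)
    (f := fun x : Site d => x + z) (add_left_injective z)⟩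

theorem measurePreserving_shiftModel {ν : Measure (Env d)} [IsProbabilityMeasure ν]
    (hν : ∀ z, ν.map (shiftEnv z) = ν) (τ : Measure ℕ) [IsProbabilityMeasure τ] (z : Site d) :
    MeasurePreserving (shiftModel z) (modelLaw ν τ) (modelLaw ν τ) :=
  MeasurePreserving.prod ⟨measurable_shiftEnv z, hν z⟩ (measurePreserving_shiftNoise τ z)

theorem mem_visitEvent_shiftEnv (z : Site d) (c : Env d) (y w : Site d) (ζ : Noise) :
    ζ ∈ visitEvent (shiftEnv z c) y w ↔ ζ ∈ visitEvent c (y + z) (w + z) := by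
  simp only [visitEvent, Set.mem_ofPred_eq, ← walk_shiftEnv, add_left_inj]

theorem mem_wakeSet_shiftEnv (z : Site d) (c : Env d) (y w : Site d) (ζ : Noise) :
    w ∈ wakeSet (shiftEnv z c) y ζ ↔ w + z ∈ wakeSet c (y + z) ζ := by
  simp only [wakeSet, Set.mem_ofPred_eq, ← walk_shiftEnv, add_left_inj]

theorem mem_range_shiftModel (z : Site d) (ω : Model d) (x w : Site d) :
    w ∈ range (shiftModel z ω).1 (shiftModel z ω).2 x ↔ w + z ∈ range ω.1 ω.2 (x + z) := by
  simp only [range, reachIn, Set.mem_ofPred_eq, Set.mem_univ, true_and, shiftModel,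
    mem_wakeSet_shiftEnv]
  constructor
  · intro h
    exact Relation.ReflTransGen.lift (· + z) (fun _ _ h => h) _ _ h
  · intro h
    have := Relation.ReflTransGen.lift
      (p := fun a b => b + z ∈ wakeSet ω.1 (a + z) (ω.2 (a + z)))
      (· - z) (fun a b h => by simpa [Function.onFun] using h) _ _ h
    simpa [Function.onFun] using this

theorem rec_shiftModel (z : Site d) (ω : Model d) (v : Site d) :
    Rec (shiftModel z ω).1 (shiftModel z ω).2 v ↔ Rec ω.1 ω.2 (v + z) := by
  rw [rec_iff, rec_iff]
  have : visitors (shiftModel z ω).1 (shiftModel z ω).2 v v =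
      (Equiv.addRight z) ⁻¹' visitors ω.1 ω.2 (v + z) (v + z) := by
    ext y
    show (_ ∧ _) ↔ (_ ∧ _)
    rw [mem_range_shiftModel]
    refine and_congr Iff.rfl ?_
    show ω.2 (y + z) ∈ _ ↔ _
    exact mem_visitEvent_shiftEnv z ω.1 y v _
  rw [this]
  constructor
  · intro h
    exact fun hf => h (hf.preimage (Equiv.addRight z).injective.injOn)
  · intro h hf
    exact h (by
      have := hf.image (Equiv.addRight z)
      rwa [Set.image_preimage_eq _ (Equiv.addRight z).surjective] at this)

theorem measurable_frogCount : Measurable fun ω : Model d => frogCount ω.2 := by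
  unfold frogCount
  fun_prop

theorem measurable_frogPath : Measurable fun ω : Model d => frogPath ω.1 ω.2 := by
  refine measurable_pi_lambda _ fun j => measurable_pi_lambda _ fun x =>
    measurable_pi_lambda _ fun i => ?_
  have h1 : Measurable fun ω : Model d => (ω.1, ω.2 x) := by fun_prop
  exact (measurable_noise_walk x i j).comp h1

theorem measurableSet_rec (v : Site d) : MeasurableSet {ω : Model d | Rec ω.1 ω.2 v} :=
  measurableSet_recurrent measurable_frogCount measurable_frogPath v

/-! ### Hitting probabilities -/

/-- The law of the uniform variables driving one walk. -/
def driverLaw : Measure (ℕ → unitInterval) :=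
  Measure.infinitePi fun _ : ℕ => (volume : Measure unitInterval)

instance : IsProbabilityMeasure driverLaw := by
  unfold driverLaw
  infer_instance

/-- The probability that the walk from `x` among the conductances `c` ever visits `A`. -/
def hitProb (c : Env d) (A : Set (Site d)) (x : Site d) : ℝ :=
  driverLaw.real {u | ∃ j, walk c x u j ∈ A}

theorem measurable_walk_left (c : Env d) (x : Site d) (j : ℕ) :
    Measurable fun u : ℕ → unitInterval => walk c x u j :=
  (measurable_walk x j).comp measurable_prodMk_left

theorem measurableSet_exists_walk_mem (c : Env d) (A : Set (Site d)) (x : Site d) :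
    MeasurableSet {u : ℕ → unitInterval | ∃ j, walk c x u j ∈ A} := by
  have : {u : ℕ → unitInterval | ∃ j, walk c x u j ∈ A} = ⋃ j, {u | walk c x u j ∈ A} := by
    ext u
    simp
  rw [this]
  exact .iUnion fun j => measurable_walk_left c x j (Set.to_countable A).measurableSet

theorem hitProb_nonneg (c : Env d) (A : Set (Site d)) (x : Site d) : 0 ≤ hitProb c A x :=
  measureReal_nonneg

theorem hitProb_le_one (c : Env d) (A : Set (Site d)) (x : Site d) : hitProb c A x ≤ 1 :=
  measureReal_le_one

theorem hitProb_of_mem (c : Env d) {A : Set (Site d)} {x : Site d} (h : x ∈ A) :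
    hitProb c A x = 1 := by
  have : {u : ℕ → unitInterval | ∃ j, walk c x u j ∈ A} = Set.univ :=
    Set.eq_univ_of_forall fun u => ⟨0, h⟩
  rw [hitProb, this, probReal_univ]

theorem hitProb_shiftEnv (z : Site d) (c : Env d) (A : Set (Site d)) (x : Site d) :
    hitProb (shiftEnv z c) {y | y + z ∈ A} x = hitProb c A (x + z) := by
  simp only [hitProb, Set.mem_ofPred_eq, walk_shiftEnv]

/-- Hitting probabilities are superharmonic. -/
theorem sum_transition_mul_hitProb_le (c : Env d) (A : Set (Site d)) (x : Site d)
    (s : Finset (Site d)) : ∑ y ∈ s, transition c x y * hitProb c A y ≤ hitProb c A x := by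
  -- `D y` uses only the drivers after the first one, hence is independent of the first step.
  -- Summing over first steps counts hits at positive times, and ignoring time `0` gives an
  -- inequality.
  let D : Site d → Set (ℕ → unitInterval) := fun y => {u | ∃ j, walk c y (fun k => u (k + 1)) j ∈ A}
  have htail : MeasurePreserving (fun (u : ℕ → unitInterval) k => u (k + 1)) driverLaw
      driverLaw :=
    ⟨by fun_prop, Measure.map_infinitePi_infinitePi_of_inj
      (P := fun _ : ℕ => (volume : Measure unitInterval)) (f := fun k => k + 1)
      (add_left_injective 1)⟩
  have hD : ∀ y, MeasurableSet (D y) := fun y =>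
    htail.measurable (measurableSet_exists_walk_mem c A y)
  have hDp : ∀ y, driverLaw (D y) = driverLaw {u | ∃ j, walk c y u j ∈ A} := fun y =>
    htail.measure_preimage (measurableSet_exists_walk_mem c A y).nullMeasurableSet
  have hstep : ∀ y, MeasurableSet {u : unitInterval | step c x u = y} := by
    intro y
    have hm : Measurable fun u => step c x u :=
      measurable_step.comp ((measurable_const.prodMk measurable_id).prodMk measurable_const)
    exact hm (measurableSet_singleton y)
  let G : Site d → Set (ℕ → unitInterval) := fun y => D y ∩ {u | u 0 ∈ {v | step c x v = y}}
  have hG : ∀ y, MeasurableSet (G y) := fun y => (hD y).inter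
    ((measurable_pi_apply 0 : Measurable fun u : ℕ → unitInterval => u 0) (hstep y))
  have hGp : ∀ y, driverLaw.real (G y) = transition c x y * hitProb c A y := by
    intro y
    rw [hitProb, measureReal_def, measureReal_def, ← hDp y]
    have := measure_inter_coord (fun _ : ℕ => (volume : Measure unitInterval)) 0 (hD y)
      (fun u v => by simp [D]) (hstep y)
    rw [volume_step_eq] at this
    show (Measure.infinitePi _ _).toReal = _
    rw [this, ENNReal.toReal_mul, ENNReal.toReal_ofReal (transition_nonneg c x y), mul_comm]
    rfl
  have hdisj : Set.PairwiseDisjoint (s : Set (Site d)) G := by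
    intro y _ y' _ hne
    rw [Function.onFun, Set.disjoint_left]
    intro u hu hu'
    exact hne (hu.2.symm.trans hu'.2)
  rw [← Finset.sum_congr rfl fun y _ => hGp y,
    ← measureReal_biUnion_finset hdisj fun y _ => hG y]
  refine measureReal_mono ?_
  intro u hu
  simp only [Set.mem_iUnion] at hu
  obtain ⟨y, -, ⟨j, hj⟩, hy⟩ := hu
  refine ⟨j + 1, ?_⟩
  rw [walk_succ']
  have hy' : step c x (u 0) = y := hy
  rwa [hy']

/-- The probability that a further walk from `x` visits a recurrent site. -/
def recProb (ω : Model d) (x : Site d) : ℝ := hitProb ω.1 {v | Rec ω.1 ω.2 v} x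

theorem recProb_shiftModel (z : Site d) (ω : Model d) (x : Site d) :
    recProb (shiftModel z ω) x = recProb ω (x + z) := by
  rw [recProb, recProb, ← hitProb_shiftEnv]
  congr 1
  ext v
  exact rec_shiftModel z ω v

theorem measurableSet_walk_hits_rec (x : Site d) :
    MeasurableSet {p : Model d × (ℕ → unitInterval) |
      ∃ j, Rec p.1.1 p.1.2 (walk p.1.1 x p.2 j)} := by
  have : {p : Model d × (ℕ → unitInterval) | ∃ j, Rec p.1.1 p.1.2 (walk p.1.1 x p.2 j)} =
      ⋃ j, ⋃ v, {p | Rec p.1.1 p.1.2 v} ∩ {p | walk p.1.1 x p.2 j = v} := by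
    ext p
    simp
  rw [this]
  refine .iUnion fun j => .iUnion fun v => .inter ?_ ?_
  · exact (measurable_fst : Measurable fun p : Model d × (ℕ → unitInterval) => p.1)
      (measurableSet_rec v)
  · have h1 : Measurable fun p : Model d × (ℕ → unitInterval) => (p.1.1, p.2) := by fun_prop
    exact ((measurable_walk x j).comp h1) (measurableSet_singleton v)

theorem measurable_recProb (x : Site d) : Measurable fun ω : Model d => recProb ω x :=
  (measurable_measure_prodMk_left (ν := driverLaw) (measurableSet_walk_hits_rec x)).ennreal_toReal

end Model

/-! ### Bounded superharmonic functions of stationary reversible environments are constant -/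

section Dirichlet

variable {d : ℕ}

/-- A stationary bounded function that is superharmonic for stationary symmetric integrable
weights takes the same value at the ends of every edge of positive weight. -/
theorem ae_eq_of_superharmonic {E : Type*} [MeasurableSpace E] {M : Measure E}
    {θ : Site d → E → E} (hθ : ∀ z, MeasurePreserving (θ z) M M)
    {k : Site d → E → ℝ} (hk0 : ∀ y ω, 0 ≤ k y ω) (hk : ∀ y, Integrable (k y) M)
    (hsymm : ∀ y ω, k (-y) (θ y ω) = k y ω) {F : E → ℝ} (hF : Measurable F)
    (hF0 : ∀ ω, 0 ≤ F ω) (hF1 : ∀ ω, F ω ≤ 1)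
    (hsuper : ∀ ω, ∑ y ∈ neighbors 0, k y ω * F (θ y ω) ≤ (∑ y ∈ neighbors 0, k y ω) * F ω) :
    ∀ᵐ ω ∂M, ∀ y ∈ neighbors 0, 0 < k y ω → F (θ y ω) = F ω := by
  have hint : ∀ y (G : E → ℝ), Measurable G → (∀ ω, |G ω| ≤ 1) →
      Integrable (fun ω => k y ω * G ω) M := by
    intro y G hG hG1
    refine (hk y).mono' ((hk y).aestronglyMeasurable.mul hG.aestronglyMeasurable) ?_
    refine ae_of_all _ fun ω => ?_
    rw [Real.norm_eq_abs, abs_mul, abs_of_nonneg (hk0 y ω)]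
    exact mul_le_of_le_one_right (hk0 y ω) (hG1 ω)
  have hFθ : ∀ y, Measurable fun ω => F (θ y ω) := fun y => hF.comp (hθ y).measurable
  have habs : ∀ a : ℝ, 0 ≤ a → a ≤ 1 → |a| ≤ 1 := fun a h0 h1 => by rwa [abs_of_nonneg h0]
  -- Reversibility: stationarity and `hsymm` turn the term of `y` into the term of `-y`, and the
  -- neighbours of the origin are symmetric.
  have hshift : ∀ G : E → ℝ, Measurable G → (∀ ω, |G ω| ≤ 1) →
      ∑ y ∈ neighbors (0 : Site d), ∫ ω, k y ω * G (θ y ω) ∂M =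
        ∑ y ∈ neighbors 0, ∫ ω, k y ω * G ω ∂M := by
    intro G hG hG1
    rw [← sum_neighbors_zero_neg fun y => ∫ ω, k y ω * G ω ∂M]
    refine Finset.sum_congr rfl fun y _ => ?_
    have hi := hint (-y) G hG hG1
    have h := integral_map (hθ y).measurable.aemeasurable
      (f := fun ω => k (-y) ω * G ω) (by rw [(hθ y).map_eq]; exact hi.aestronglyMeasurable)
    rw [(hθ y).map_eq] at h
    rw [h]
    simp only [hsymm]
  have hi1 : ∀ y, Integrable (fun ω => k y ω * F ω) M := fun y =>
    hint y F hF fun ω => habs _ (hF0 ω) (hF1 ω)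
  have hi2 : ∀ y, Integrable (fun ω => k y ω * F (θ y ω)) M := fun y =>
    hint y _ (hFθ y) fun ω => habs _ (hF0 _) (hF1 _)
  have hi6 : ∀ y, Integrable (fun ω => k y ω * F ω - k y ω * F (θ y ω)) M := fun y =>
    (hi1 y).sub (hi2 y)
  -- The superharmonic defect is nonnegative and has mean zero by `hshift`, so `F` is almost surely
  -- harmonic.
  let Δ : E → ℝ := fun ω => ∑ y ∈ neighbors 0, (k y ω * F ω - k y ω * F (θ y ω))
  have hΔ0 : ∀ ω, 0 ≤ Δ ω := by
    intro ω
    have := hsuper ω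
    rw [Finset.sum_mul] at this
    simp only [Δ, Finset.sum_sub_distrib]
    linarith
  have hΔi : Integrable Δ M := integrable_finsetSum _ fun y _ => hi6 y
  have hΔ : ∀ᵐ ω ∂M, Δ ω = 0 := by
    have : ∫ ω, Δ ω ∂M = 0 := by
      simp only [Δ]
      rw [integral_finsetSum _ fun y _ => hi6 y]
      simp only [integral_sub (hi1 _) (hi2 _)]
      rw [Finset.sum_sub_distrib, hshift F hF fun ω => habs _ (hF0 ω) (hF1 ω), sub_self]
    exact (integral_eq_zero_iff_of_nonneg hΔ0 hΔi).1 this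
  have hsq1 : ∀ ω, |F ω ^ 2| ≤ 1 := fun ω =>
    habs _ (sq_nonneg _) (pow_le_one₀ (hF0 ω) (hF1 ω))
  have hi3 : ∀ y, Integrable (fun ω => k y ω * F ω ^ 2) M := fun y =>
    hint y _ (hF.pow_const 2) hsq1
  have hi4 : ∀ y, Integrable (fun ω => k y ω * F (θ y ω) ^ 2) M := fun y =>
    hint y _ ((hFθ y).pow_const 2) fun ω => hsq1 (θ y ω)
  have hi5 : ∀ y, Integrable (fun ω => k y ω * (F (θ y ω) ^ 2 - F ω ^ 2)) M := by
    intro y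
    have := (hi4 y).sub (hi3 y)
    refine this.congr (ae_of_all _ fun ω => ?_)
    simp only [Pi.sub_apply]
    ring
  let Q : E → ℝ := fun ω => ∑ y ∈ neighbors 0, k y ω * (F (θ y ω) - F ω) ^ 2
  have hQ0 : ∀ ω, 0 ≤ Q ω := fun ω =>
    Finset.sum_nonneg fun y _ => mul_nonneg (hk0 y ω) (sq_nonneg _)
  have hQeq : Q =ᵐ[M] fun ω => ∑ y ∈ neighbors 0, k y ω * (F (θ y ω) ^ 2 - F ω ^ 2) := by
    filter_upwards [hΔ] with ω hω
    -- This is `(b - a)² = (b² - a²) + 2a(a - b)`. The defect vanishes, and the remaining sum has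
    -- mean zero by `hshift` applied to `F²`; hence the Dirichlet energy `Q` vanishes.
    have : Q ω = (∑ y ∈ neighbors 0, k y ω * (F (θ y ω) ^ 2 - F ω ^ 2)) + 2 * F ω * Δ ω := by
      simp only [Q, Δ, Finset.mul_sum, ← Finset.sum_add_distrib]
      exact Finset.sum_congr rfl fun y _ => by ring
    rw [this, hω, mul_zero, add_zero]
  have hQi : Integrable Q M := (integrable_finsetSum _ fun y _ => hi5 y).congr hQeq.symm
  have hQ : ∀ᵐ ω ∂M, Q ω = 0 := by
    have : ∫ ω, Q ω ∂M = 0 := by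
      rw [integral_congr_ae hQeq, integral_finsetSum _ fun y _ => hi5 y]
      simp only [mul_sub]
      simp only [integral_sub (hi4 _) (hi3 _)]
      rw [Finset.sum_sub_distrib, hshift (fun ω => F ω ^ 2) (hF.pow_const 2) hsq1, sub_self]
    exact (integral_eq_zero_iff_of_nonneg hQ0 hQi).1 this
  filter_upwards [hQ] with ω hω y hy hpos
  have := (Finset.sum_eq_zero_iff_of_nonneg fun y _ =>
    mul_nonneg (hk0 y ω) (sq_nonneg (F (θ y ω) - F ω))).1 hω y hy
  have h2 := (mul_eq_zero.1 this).resolve_left hpos.ne'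
  exact sub_eq_zero.1 (pow_eq_zero_iff two_ne_zero |>.1 h2)

theorem integrable_conductance {ν : Measure (Env d)}
    (hq : ∫⁻ c, (totalConductance c 0 : ℝ≥0∞) ∂ν < ∞) (y : Site d) :
    Integrable (fun c : Env d => (conductance c 0 y : ℝ)) ν := by
  refine ⟨by fun_prop, lt_of_le_of_lt (lintegral_mono fun c => ?_) hq⟩
  rw [show ‖(conductance c 0 y : ℝ)‖ₑ = (conductance c 0 y : ℝ≥0∞) by simp]
  refine ENNReal.coe_le_coe.2 ?_
  by_cases hy : y ∈ neighbors 0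
  · exact Finset.single_le_sum (f := fun y => conductance c 0 y) (fun _ _ => zero_le) hy
  · rw [conductance_eq_zero_of_notMem c hy]
    exact zero_le

/-- A walk from a cluster that contains a recurrent site almost surely visits a recurrent site. -/
theorem ae_recProb_eq_one {ν : Measure (Env d)} [IsProbabilityMeasure ν]
    (hν : ∀ z, ν.map (shiftEnv z) = ν) (τ : Measure ℕ) [IsProbabilityMeasure τ]
    (hq : ∫⁻ c, (totalConductance c 0 : ℝ≥0∞) ∂ν < ∞) :
    ∀ᵐ ω ∂modelLaw ν τ, ∀ x v, v ∈ cluster ω.1 x → Rec ω.1 ω.2 v → recProb ω x = 1 := by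
  have hθ := measurePreserving_shiftModel hν τ
  have h0 : ∀ᵐ ω ∂modelLaw ν τ, ∀ y ∈ neighbors 0, 0 < (conductance ω.1 0 y : ℝ) →
      recProb (shiftModel y ω) 0 = recProb ω 0 := by
    refine ae_eq_of_superharmonic hθ (k := fun y ω => (conductance ω.1 0 y : ℝ))
      (F := fun ω => recProb ω 0) (fun y ω => NNReal.coe_nonneg _) (fun y => ?_) (fun y ω => ?_)
      (measurable_recProb 0) (fun ω => hitProb_nonneg _ _ _) (fun ω => hitProb_le_one _ _ _)
      fun ω => ?_
    · exact (integrable_conductance hq y).comp_fst (noiseField d τ)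
    · show (conductance (shiftEnv y ω.1) 0 (-y) : ℝ) = conductance ω.1 0 y
      rw [conductance_shiftEnv, conductance_comm]
      simp
    · classical
      have h1 := sum_transition_mul_hitProb_le ω.1 {v | Rec ω.1 ω.2 v} 0 (neighbors 0)
      have h2 := mul_le_mul_of_nonneg_left h1 (NNReal.coe_nonneg (totalConductance ω.1 0))
      rw [Finset.mul_sum] at h2
      simp only [recProb_shiftModel, zero_add]
      refine le_trans (le_of_eq (Finset.sum_congr rfl fun y _ => ?_)) (h2.trans (le_of_eq ?_))
      · rw [← totalConductance_mul_transition, mul_assoc]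
        rfl
      · rw [totalConductance, NNReal.coe_sum]
        rfl
  have h1 : ∀ᵐ ω ∂modelLaw ν τ, ∀ x y : Site d, y ∈ neighbors 0 →
      0 < (conductance ω.1 x (y + x) : ℝ) → recProb ω (y + x) = recProb ω x := by
    rw [ae_all_iff]
    intro x
    filter_upwards [(hθ x).quasiMeasurePreserving.ae h0] with ω hω y hy hpos
    have := hω y hy (by
      show 0 < (conductance (shiftEnv x ω.1) 0 y : ℝ)
      rwa [conductance_shiftEnv, zero_add])
    simpa only [recProb_shiftModel, zero_add] using this
  filter_upwards [h1] with ω hω x v hv hrec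
  have hconst : recProb ω v = recProb ω x := by
    have hv' : Relation.ReflTransGen (fun u v => 0 < conductance ω.1 u v) x v := hv
    clear hrec hv
    induction hv' with
    | refl => rfl
    | @tail a b _ hab ih =>
      rw [← ih]
      have hb : b ∈ neighbors a := by
        by_contra h
        exact hab.ne' (conductance_eq_zero_of_notMem _ h)
      have hb' : b - a ∈ neighbors 0 := by
        rw [← add_mem_neighbors_add 0 (b - a) a]
        simpa using hb
      have := hω a (b - a) hb' (by simpa using hab)
      simpa using this
  rw [← hconst]
  exact hitProb_of_mem ω.1 hrec

end Dirichlet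

/-! ### Resampling the frogs of one site -/

section ResampleSite

variable {d : ℕ}

/-- Replaces the randomness attached to the site `x`. -/
def resample (x : Site d) (p : Model d × Noise) : Model d :=
  (p.1.1, Function.update p.1.2 x p.2)

theorem measurePreserving_resample (ν : Measure (Env d)) [IsProbabilityMeasure ν] (τ : Measure ℕ)
    [IsProbabilityMeasure τ] (x : Site d) :
    MeasurePreserving (resample x) ((modelLaw ν τ).prod (noiseLaw τ)) (modelLaw ν τ) := by
  have h1 := measurePreserving_prodAssoc ν (noiseField d τ) (noiseLaw τ)
  have h2 := (MeasurePreserving.id ν).prod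
    (measurePreserving_update (fun _ : Site d => noiseLaw τ) x)
  exact h2.comp h1

/-- If resampling yields two independent copies that almost surely are not both in `Z`, then `Z`
is a null set. -/
theorem ae_notMem_of_resample {ν : Measure (Env d)} [IsProbabilityMeasure ν] {τ : Measure ℕ}
    [IsProbabilityMeasure τ] (x : Site d) {Z : Set (Model d)} (hZ : MeasurableSet Z)
    (h : ∀ᵐ p ∂(modelLaw ν τ).prod (noiseLaw τ), p.1 ∈ Z → resample x p ∉ Z) :
    ∀ᵐ ω ∂modelLaw ν τ, ω ∉ Z := by
  have hT := measurePreserving_resample ν τ x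
  have h1 : ∀ᵐ ω ∂modelLaw ν τ, ω ∈ Z → ∀ᵐ ζ ∂noiseLaw τ, resample x (ω, ζ) ∉ Z := by
    filter_upwards [Measure.ae_ae_of_ae_prod h] with ω hω hmem
    filter_upwards [hω] with ζ hζ
    exact hζ hmem
  -- A second resampling overwrites the first. Thus if one fresh copy lands in `Z`, almost every
  -- other copy misses `Z`; but that is a statement about the remaining noise only, so almost every
  -- copy misses `Z` in any case.
  have h2 := hT.quasiMeasurePreserving.ae h1
  have h3 : ∀ᵐ ω ∂modelLaw ν τ, ∀ᵐ ζ ∂noiseLaw τ, resample x (ω, ζ) ∉ Z := by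
    filter_upwards [Measure.ae_ae_of_ae_prod h2] with ω hω
    by_contra hN
    refine hN ?_
    filter_upwards [hω] with ζ hζ hmem
    refine hN ?_
    simpa [resample] using hζ hmem
  have h4 : ∀ᵐ p ∂(modelLaw ν τ).prod (noiseLaw τ), resample x p ∉ Z :=
    (Measure.ae_prod_iff_ae_ae (hT.measurable hZ.compl)).2 h3
  rw [← hT.map_eq]
  exact (ae_map_iff hT.measurable.aemeasurable hZ.compl).2 h4

theorem measurableSet_mem_range (x y : Site d) :
    MeasurableSet {ω : Model d | y ∈ range ω.1 ω.2 x} := by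
  refine measurableSet_reflTransGen (R := fun (ω : Model d) a b =>
    a ∈ Set.univ ∧ b ∈ Set.univ ∧ b ∈ wakeSet ω.1 a (ω.2 a)) (fun a b => ?_) x y
  have h1 : Measurable fun ω : Model d => (ω.1, ω.2 a) := by fun_prop
  exact (MeasurableSet.const _).inter ((MeasurableSet.const _).inter (h1 (measurableSet_wake a b)))

theorem measurableSet_visitors_infinite (x v : Site d) :
    MeasurableSet {ω : Model d | (visitors ω.1 ω.2 x v).Infinite} := by
  refine measurableSet_setOf_infinite fun y => (measurableSet_mem_range x y).inter ?_
  have h1 : Measurable fun ω : Model d => (ω.1, ω.2 y) := by fun_prop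
  exact h1 (measurableSet_visit y v)

theorem ae_modelLaw_visitors_infinite (ν : Measure (Env d)) [IsProbabilityMeasure ν]
    (τ : Measure ℕ) [IsProbabilityMeasure τ] :
    ∀ᵐ ω ∂modelLaw ν τ, ∀ x v w, w ∈ cluster ω.1 v →
      (visitors ω.1 ω.2 x v).Infinite → (visitors ω.1 ω.2 x w).Infinite := by
  have hm : MeasurableSet {ω : Model d | ∀ x v w, w ∈ cluster ω.1 v →
      (visitors ω.1 ω.2 x v).Infinite → (visitors ω.1 ω.2 x w).Infinite} := by
    simp only [Set.ofPred_forall]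
    refine .iInter fun x => .iInter fun v => .iInter fun w => ?_
    have h : MeasurableSet {ω : Model d | w ∈ cluster ω.1 v} :=
      measurable_fst (measurableSet_mem_cluster v w)
    exact h.imp ((measurableSet_visitors_infinite x v).imp (measurableSet_visitors_infinite x w))
  exact (Measure.ae_prod_iff_ae_ae hm).2 (ae_of_all _ fun c => ae_visitors_infinite τ c)

theorem measurePreserving_driver (τ : Measure ℕ) [IsProbabilityMeasure τ] (i : ℕ+) :
    MeasurePreserving (fun (ζ : Noise) k => ζ.2 (i, k)) (noiseLaw τ) driverLaw := by
  have h1 : MeasurePreserving (fun (U : ℕ+ × ℕ → unitInterval) k => U (i, k))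
      (Measure.infinitePi fun _ : ℕ+ × ℕ => (volume : Measure unitInterval)) driverLaw :=
    ⟨by fun_prop, Measure.map_infinitePi_infinitePi_of_inj
      (P := fun _ : ℕ+ × ℕ => (volume : Measure unitInterval)) (f := fun k => (i, k))
      (Prod.mk_right_injective i)⟩
  exact h1.comp measurePreserving_snd

/-- If `v` is recurrent and the resampled frogs of `x` visit `v`, then infinitely many frogs of
the process from `x` visit `v`, before or after the resampling. -/
theorem visitors_infinite_or {c : Env d} {ξ : Site d → Noise} {x v : Site d} {ζ : Noise}
    (hv : v ∈ range c (Function.update ξ x ζ) x) (hrec : Rec c ξ v) :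
    (visitors c ξ x v).Infinite ∨ (visitors c (Function.update ξ x ζ) x v).Infinite := by
  -- Follow a chain of wakings from `v` in the old noise. As long as it does not use the frogs of
  -- `x`, it also exists in the new noise, where `v` is reached from `x`. Once it uses the frogs of
  -- `x`, everything afterwards is reached from `x` in the old noise.
  have hrange : ∀ y ∈ range c ξ v, y ∈ range c ξ x ∨ y ∈ range c (Function.update ξ x ζ) x := by
    intro y hy
    induction hy with
    | refl => exact .inr hv
    | @tail a b _ hab ih =>
      by_cases hax : a = x
      · subst hax
        exact .inl (Relation.ReflTransGen.single hab)
      · rcases ih with h | h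
        · exact .inl (h.tail hab)
        · refine .inr (h.tail ⟨hab.1, hab.2.1, ?_⟩)
          rw [Function.update_of_ne hax]
          exact hab.2.2
  rw [rec_iff] at hrec
  -- Only the frogs of `x` change under the update, so `x` is the single visitor that may be lost.
  have hsub : visitors c ξ v v ⊆
      visitors c ξ x v ∪ (visitors c (Function.update ξ x ζ) x v ∪ {x}) := by
    rintro y ⟨hy, hyv⟩
    rcases hrange y hy with h | h
    · exact .inl ⟨h, hyv⟩
    · by_cases hyx : y = x
      · exact .inr (.inr hyx)
      · refine .inr (.inl ⟨h, ?_⟩)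
        rw [Function.update_of_ne hyx]
        exact hyv
  by_contra! hfin
  exact hrec ((hfin.1.union (hfin.2.union (Set.finite_singleton x))).subset hsub)

theorem walk_mem_range {c : Env d} {ξ : Site d → Noise} {x : Site d} (h : 1 ≤ (ξ x).1) (j : ℕ) :
    walk c x (fun k => (ξ x).2 (1, k)) j ∈ range c ξ x := by
  cases j with
  | zero => exact Relation.ReflTransGen.refl
  | succ j =>
    exact Relation.ReflTransGen.single ⟨Set.mem_univ _, Set.mem_univ _, 1, by simpa using h, j, rfl⟩

theorem range_subset_cluster (c : Env d) (ξ : Site d → Noise) (x : Site d) :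
    range c ξ x ⊆ cluster c x := by
  intro y hy
  induction hy with
  | refl => exact Relation.ReflTransGen.refl
  | @tail a b _ hab ih =>
    obtain ⟨i, -, j, rfl⟩ := hab.2.2
    exact Relation.ReflTransGen.trans ih (walk_mem_cluster c a _ _)

/-- The infinitely many visitors come from sites of the range, and frogs never leave their cluster.
With uniqueness of the infinite cluster, this places any recurrent site in the infinite cluster of
`x`. -/
theorem cluster_infinite_of_rec {c : Env d} {ξ : Site d → Noise} {v : Site d} (h : Rec c ξ v) :
    (cluster c v).Infinite :=
  ((rec_iff c ξ v).1 h).mono fun _ hy => range_subset_cluster c ξ v hy.1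

theorem mem_cluster_comm {c : Env d} {x y : Site d} (h : y ∈ cluster c x) : x ∈ cluster c y := by
  rw [cluster_eq_of_mem h]
  exact Relation.ReflTransGen.refl

variable {ν : Measure (Env d)} [IsProbabilityMeasure ν] {τ : Measure ℕ} [IsProbabilityMeasure τ]

/-- The first resampled frog of `x` is a fresh walk, independent of the old model, so it hits some
old-recurrent site `v`. Then `visitors_infinite_or` gives infinitely many visitors at `v` in one of
the two configurations. As `x` lies in the cluster of `v`, they can be exchanged for visitors at `x`
in that same configuration. -/
theorem ae_rec_or_rec_resample (hν : ∀ z, ν.map (shiftEnv z) = ν)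
    (hq : ∫⁻ c, (totalConductance c 0 : ℝ≥0∞) ∂ν < ∞) (x : Site d) :
    ∀ᵐ p ∂(modelLaw ν τ).prod (noiseLaw τ),
      (∃ v ∈ cluster p.1.1 x, Rec p.1.1 p.1.2 v) → 1 ≤ p.2.1 →
        Rec p.1.1 p.1.2 x ∨ Rec (resample x p).1 (resample x p).2 x := by
  have hvis := ae_modelLaw_visitors_infinite ν τ
  have hvis1 : ∀ᵐ p ∂(modelLaw ν τ).prod (noiseLaw τ), ∀ x v w, w ∈ cluster p.1.1 v →
      (visitors p.1.1 p.1.2 x v).Infinite → (visitors p.1.1 p.1.2 x w).Infinite :=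
    Measure.quasiMeasurePreserving_fst.ae hvis
  have hvis2 := (measurePreserving_resample ν τ x).quasiMeasurePreserving.ae hvis
  have hhit : ∀ᵐ p ∂(modelLaw ν τ).prod (noiseLaw τ),
      (∃ v ∈ cluster p.1.1 x, Rec p.1.1 p.1.2 v) →
        ∃ j, Rec p.1.1 p.1.2 (walk p.1.1 x (fun k => p.2.2 (1, k)) j) := by
    have hm : MeasurableSet {p : Model d × Noise | (∃ v ∈ cluster p.1.1 x, Rec p.1.1 p.1.2 v) →
        ∃ j, Rec p.1.1 p.1.2 (walk p.1.1 x (fun k => p.2.2 (1, k)) j)} := by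
      refine MeasurableSet.imp ?_ ?_
      · have : {p : Model d × Noise | ∃ v ∈ cluster p.1.1 x, Rec p.1.1 p.1.2 v} =
            ⋃ v, (fun p : Model d × Noise => p.1.1) ⁻¹' {c | v ∈ cluster c x} ∩
              Prod.fst ⁻¹' {ω : Model d | Rec ω.1 ω.2 v} := by
          ext p
          simp
        rw [this]
        exact .iUnion fun v => ((by fun_prop : Measurable fun p : Model d × Noise => p.1.1)
          (measurableSet_mem_cluster x v)).inter (measurable_fst (measurableSet_rec v))
      · have h1 : Measurable fun p : Model d × Noise => (p.1, fun k : ℕ => p.2.2 (1, k)) := by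
          fun_prop
        exact h1 (measurableSet_walk_hits_rec x)
    refine (Measure.ae_prod_iff_ae_ae hm).2 ?_
    filter_upwards [ae_recProb_eq_one hν τ hq] with ω hω
    by_cases hex : ∃ v ∈ cluster ω.1 x, Rec ω.1 ω.2 v
    · obtain ⟨v, hv, hr⟩ := hex
      have h1 : driverLaw {u | ∃ j, Rec ω.1 ω.2 (walk ω.1 x u j)} = 1 := by
        have h2 := hω x v hv hr
        rw [recProb, hitProb, measureReal_def] at h2
        rw [← ENNReal.ofReal_one, ← h2, ENNReal.ofReal_toReal (measure_ne_top _ _)]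
        rfl
      have h2 : ∀ᵐ u ∂driverLaw, ∃ j, Rec ω.1 ω.2 (walk ω.1 x u j) :=
        (mem_ae_iff_prob_eq_one
          (measurableSet_exists_walk_mem ω.1 {v | Rec ω.1 ω.2 v} x)).2 h1
      filter_upwards [(measurePreserving_driver τ 1).quasiMeasurePreserving.ae h2] with ζ hζ _
      exact hζ
    · exact ae_of_all _ fun ζ h => absurd h hex
  filter_upwards [hvis1, hvis2, hhit] with p h1 h2 h3 hex hcount
  obtain ⟨j, hj⟩ := h3 hex
  have hcl := walk_mem_cluster p.1.1 x (fun k => p.2.2 (1, k)) j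
  have hmem : walk p.1.1 x (fun k => p.2.2 (1, k)) j ∈
      range p.1.1 (Function.update p.1.2 x p.2) x := by
    have := walk_mem_range (c := p.1.1) (ξ := Function.update p.1.2 x p.2) (x := x)
      (by simpa using hcount) j
    simpa using this
  rw [rec_iff, rec_iff]
  rcases visitors_infinite_or hmem hj with h | h
  · exact .inl (h1 x _ x (mem_cluster_comm hcl) h)
  · exact .inr (h2 x _ x (mem_cluster_comm hcl) h)

/-- If almost surely there is a recurrent site, then every site of the infinite cluster that has a
frog is recurrent. -/
theorem ae_rec_of_ae_exists_rec (hν : ∀ z, ν.map (shiftEnv z) = ν)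
    (hq : ∫⁻ c, (totalConductance c 0 : ℝ≥0∞) ∂ν < ∞)
    (huniq : ∀ᵐ c ∂ν, ∀ x y : Site d, (cluster c x).Infinite → (cluster c y).Infinite →
      cluster c x = cluster c y)
    (hex : ∀ᵐ ω ∂modelLaw ν τ, ∃ v, Rec ω.1 ω.2 v) :
    ∀ᵐ ω ∂modelLaw ν τ, ∀ x, 1 ≤ (ω.2 x).1 → (cluster ω.1 x).Infinite → Rec ω.1 ω.2 x := by
  rw [ae_all_iff]
  intro x
  let Z : Set (Model d) :=
    {ω | 1 ≤ (ω.2 x).1} ∩ ({ω | (cluster ω.1 x).Infinite} ∩ {ω | Rec ω.1 ω.2 x}ᶜ)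
  have hZ : MeasurableSet Z := by
    refine .inter (measurableSet_le measurable_const (by fun_prop)) (.inter ?_
      (measurableSet_rec x).compl)
    exact measurable_fst (measurableSet_cluster_infinite x)
  have huniq' : ∀ᵐ ω ∂modelLaw ν τ, ∀ x y : Site d, (cluster ω.1 x).Infinite →
      (cluster ω.1 y).Infinite → cluster ω.1 x = cluster ω.1 y :=
    Measure.quasiMeasurePreserving_fst.ae huniq
  have hcl : ∀ᵐ ω ∂modelLaw ν τ, (cluster ω.1 x).Infinite →
      ∃ v ∈ cluster ω.1 x, Rec ω.1 ω.2 v := by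
    filter_upwards [hex, huniq'] with ω ⟨v, hv⟩ hu hinf
    refine ⟨v, ?_, hv⟩
    rw [hu x v hinf (cluster_infinite_of_rec hv)]
    exact Relation.ReflTransGen.refl
  have hmain : ∀ᵐ ω ∂modelLaw ν τ, ω ∉ Z := by
    refine ae_notMem_of_resample x hZ ?_
    have hcl' : ∀ᵐ p ∂(modelLaw ν τ).prod (noiseLaw τ), (cluster p.1.1 x).Infinite →
        ∃ v ∈ cluster p.1.1 x, Rec p.1.1 p.1.2 v :=
      Measure.quasiMeasurePreserving_fst.ae hcl
    filter_upwards [hcl', ae_rec_or_rec_resample hν hq x] with p h1 h2 hp hp'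
    have hcount : 1 ≤ p.2.1 := by
      have : 1 ≤ ((resample x p).2 x).1 := hp'.1
      simpa [resample] using this
    rcases h2 (h1 hp.2.1) hcount with h | h
    · exact hp.2.2 h
    · exact hp'.2.2 h
  filter_upwards [hmain] with ω hω h1 h2
  by_contra h3
  exact hω ⟨h1, h2, h3⟩

end ResampleSite

/-! ### Invariant events of the model are trivial -/

section JointErgodicity

theorem measurePreserving_mix {ι X : Type*} [MeasurableSpace X] [DecidableEq ι]
    (μ : ι → Measure X) [∀ i, IsProbabilityMeasure (μ i)] (K : Finset ι) :
    MeasurePreserving (fun (p : (ι → X) × (ι → X)) i => if i ∈ K then p.1 i else p.2 i)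
      ((Measure.infinitePi μ).prod (Measure.infinitePi μ)) (Measure.infinitePi μ) := by
  have hm : Measurable (fun (p : (ι → X) × (ι → X)) i => if i ∈ K then p.1 i else p.2 i) := by
    refine measurable_pi_lambda _ fun i => ?_
    by_cases h : i ∈ K
    · simp only [h, if_true]; fun_prop
    · simp only [h, if_false]; fun_prop
  refine ⟨hm, Measure.eq_infinitePi _ fun s t ht => ?_⟩
  rw [Measure.map_apply hm (.pi s.countable_toSet fun _ _ => ht _)]
  have : (fun (p : (ι → X) × (ι → X)) i => if i ∈ K then p.1 i else p.2 i) ⁻¹' Set.pi s t =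
      (Set.pi (s.filter (· ∈ K)) t) ×ˢ (Set.pi (s.filter (· ∉ K)) t) := by
    ext ⟨f, g⟩
    simp only [Set.mem_preimage, Set.mem_pi, Finset.mem_coe, Set.mem_prod, Finset.mem_filter]
    constructor
    · intro h
      exact ⟨fun i hi => by simpa [hi.2] using h i hi.1, fun i hi => by simpa [hi.2] using h i hi.1⟩
    · rintro ⟨h1, h2⟩ i hi
      by_cases hK : i ∈ K
      · simpa [hK] using h1 i ⟨hi, hK⟩
      · simpa [hK] using h2 i ⟨hi, hK⟩
  rw [this, Measure.prod_prod, Measure.infinitePi_pi _ (fun j _ => ht j),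
    Measure.infinitePi_pi _ (fun j _ => ht j), Finset.prod_filter_mul_prod_filter_not]

/-- Gluing the `K`-coordinates of one copy to the remaining coordinates of an independent copy
preserves the law, and the intersection pulls back to a rectangle. -/
theorem measure_inter_of_disjoint_coords {ι X : Type*} [MeasurableSpace X]
    (μ : ι → Measure X) [∀ i, IsProbabilityMeasure (μ i)] {K : Finset ι} {A B : Set (ι → X)}
    (hA : MeasurableSet A) (hB : MeasurableSet B)
    (hAK : ∀ f g, (∀ i ∈ K, f i = g i) → (f ∈ A ↔ g ∈ A))
    (hBK : ∀ f g, (∀ i ∉ K, f i = g i) → (f ∈ B ↔ g ∈ B)) :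
    Measure.infinitePi μ (A ∩ B) = Measure.infinitePi μ A * Measure.infinitePi μ B := by
  classical
  rw [← (measurePreserving_mix μ K).measure_preimage (hA.inter hB).nullMeasurableSet,
    ← Measure.prod_prod]
  congr 1
  ext ⟨f, g⟩
  exact and_congr (hAK _ _ fun i hi => by simp [hi]) (hBK _ _ fun i hi => by simp [hi])

variable {d : ℕ}

/-- The events that depend on the frogs of finitely many sites only. -/
def finitaryEvents (d : ℕ) : Set (Set (Model d)) :=
  {S | MeasurableSet S ∧ ∃ K : Finset (Site d), ∀ c ξ ξ', (∀ x ∈ K, ξ x = ξ' x) →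
    ((c, ξ) ∈ S ↔ (c, ξ') ∈ S)}

theorem isSetRing_finitaryEvents : IsSetRing (finitaryEvents d) where
  empty_mem := ⟨.empty, ∅, fun _ _ _ _ => Iff.rfl⟩
  union_mem := by
    classical
    rintro S T ⟨hS, K, hK⟩ ⟨hT, L, hL⟩
    exact ⟨hS.union hT, K ∪ L, fun c ξ ξ' h => or_congr
      (hK c ξ ξ' fun x hx => h x (Finset.mem_union_left _ hx))
      (hL c ξ ξ' fun x hx => h x (Finset.mem_union_right _ hx))⟩
  sdiff_mem := by
    classical
    rintro S T ⟨hS, K, hK⟩ ⟨hT, L, hL⟩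
    exact ⟨hS.diff hT, K ∪ L, fun c ξ ξ' h => and_congr
      (hK c ξ ξ' fun x hx => h x (Finset.mem_union_left _ hx))
      (not_congr (hL c ξ ξ' fun x hx => h x (Finset.mem_union_right _ hx)))⟩

theorem generateFrom_finitaryEvents :
    (inferInstance : MeasurableSpace (Model d)) =
      MeasurableSpace.generateFrom (finitaryEvents d) := by
  apply le_antisymm
  · have h1 : @Measurable _ _ (MeasurableSpace.generateFrom (finitaryEvents d)) _
        (fun ω : Model d => ω.1) := fun s hs =>
      MeasurableSpace.measurableSet_generateFrom
        ⟨measurable_fst hs, ∅, fun _ _ _ _ => Iff.rfl⟩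
    have h2 : @Measurable _ _ (MeasurableSpace.generateFrom (finitaryEvents d)) _
        (fun ω : Model d => ω.2) := by
      refine @measurable_pi_lambda _ _ _ (MeasurableSpace.generateFrom (finitaryEvents d)) _ _ ?_
      intro x s hs
      have hm : Measurable fun ω : Model d => ω.2 x := by fun_prop
      refine MeasurableSpace.measurableSet_generateFrom ⟨hm hs, {x}, fun c ξ ξ' h => ?_⟩
      show ξ x ∈ s ↔ ξ' x ∈ s
      rw [h x (Finset.mem_singleton_self x)]
    exact sup_le h1.comap_le h2.comap_le
  · exact MeasurableSpace.generateFrom_le fun S hS => hS.1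

/-- Invariance of `T` trades the shift of the environment for a shift of the noise, and the law of
the noise is shift-invariant. The conditional probability of `T` is thus an invariant function of
the conductances. -/
theorem noiseField_section_shiftEnv (τ : Measure ℕ) [IsProbabilityMeasure τ] {T : Set (Model d)}
    (hT : MeasurableSet T) (hinv : ∀ z ω, shiftModel z ω ∈ T ↔ ω ∈ T) (z : Site d) (c : Env d) :
    noiseField d τ {ξ | (shiftEnv z c, ξ) ∈ T} = noiseField d τ {ξ | (c, ξ) ∈ T} := by
  have := (measurePreserving_shiftNoise τ z).measure_preimage
    (measurable_prodMk_left hT : MeasurableSet {ξ | (shiftEnv z c, ξ) ∈ T}).nullMeasurableSet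
  refine this.symm.trans ?_
  congr 1
  ext ξ
  exact hinv z (c, ξ)

variable {ν : Measure (Env d)} [IsProbabilityMeasure ν] {τ : Measure ℕ} [IsProbabilityMeasure τ]

/-- The conditional probability of an invariant event is, in the mean, at most its square. -/
theorem lintegral_section_le_sq (hd : 0 < d) (hν : ∀ z, ν.map (shiftEnv z) = ν)
    {T : Set (Model d)} (hT : MeasurableSet T) (hinv : ∀ z ω, shiftModel z ω ∈ T ↔ ω ∈ T) :
    ∫⁻ c, noiseField d τ {ξ | (c, ξ) ∈ T} ∂ν ≤
      ∫⁻ c, noiseField d τ {ξ | (c, ξ) ∈ T} * noiseField d τ {ξ | (c, ξ) ∈ T} ∂ν := by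
  classical
  set α : Env d → ℝ≥0∞ := fun c => noiseField d τ {ξ | (c, ξ) ∈ T} with hα
  have hαm : Measurable α := measurable_measure_prodMk_left hT
  refine ENNReal.le_of_forall_pos_le_add fun ε hε _ => ?_
  -- The tolerance `ε / 4` is spent four times: twice for replacing `T` by `T'` and by its shift,
  -- and twice for replacing `β` by `α` in the two factors.
  obtain ⟨T', ⟨hT', K, hK⟩, hclose⟩ :=
    exists_measure_symmDiff_lt_of_generateFrom_isSetRing (μ := modelLaw ν τ)
      isSetRing_finitaryEvents
      ⟨{Set.univ}, Set.countable_singleton _, by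
        rintro _ rfl
        exact ⟨.univ, ∅, fun _ _ _ _ => Iff.rfl⟩, by simp⟩
      generateFrom_finitaryEvents hT (ε := (ε : ℝ≥0∞) / 4)
      (ENNReal.div_pos (by exact_mod_cast hε.ne') (by norm_num))
  have hinf : Infinite (Site d) := by
    have : Nonempty (Fin d) := ⟨⟨0, hd⟩⟩
    infer_instance
  -- For `z` outside `K - K`, the set `K` and its translate by `z` are disjoint. Given the
  -- conductances, `T'` and its shift are then independent.
  obtain ⟨z, hz⟩ := Infinite.exists_notMem_finset (Finset.image₂ (fun a b => a - b) K K)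
  have hθ := measurePreserving_shiftModel hν τ z
  have hsT' : MeasurableSet (shiftModel z ⁻¹' T') := hθ.measurable hT'
  let δ : Env d → ℝ≥0∞ := fun c => noiseField d τ {ξ | (c, ξ) ∈ T' \ T}
  let β : Env d → ℝ≥0∞ := fun c => noiseField d τ {ξ | (c, ξ) ∈ T'}
  have hδm : Measurable δ := measurable_measure_prodMk_left (hT'.diff hT)
  have hδ : ∫⁻ c, δ c ∂ν ≤ (ε : ℝ≥0∞) / 4 := by
    have : ∫⁻ c, δ c ∂ν = modelLaw ν τ (T' \ T) := (Measure.prod_apply (hT'.diff hT)).symm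
    rw [this]
    exact (measure_mono Set.subset_union_left).trans hclose.le
  have hδs : ∫⁻ c, δ (shiftEnv z c) ∂ν ≤ (ε : ℝ≥0∞) / 4 := by
    rw [← lintegral_map hδm (measurable_shiftEnv z), hν z]
    exact hδ
  have hβ : ∀ c, β c ≤ α c + δ c := by
    intro c
    refine (measure_mono fun ξ hξ => ?_).trans (measure_union_le _ _)
    by_cases h : (c, ξ) ∈ T
    · exact .inl h
    · exact .inr ⟨hξ, h⟩
  have hα1 : ∀ c, α c ≤ 1 := fun c => prob_le_one
  have hβ1 : ∀ c, β c ≤ 1 := fun c => prob_le_one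
  have hαs : ∀ c, α (shiftEnv z c) = α c := fun c => noiseField_section_shiftEnv τ hT hinv z c
  have hmix : modelLaw ν τ (T' ∩ shiftModel z ⁻¹' T') = ∫⁻ c, β c * β (shiftEnv z c) ∂ν := by
    rw [modelLaw, Measure.prod_apply (hT'.inter hsT')]
    refine lintegral_congr fun c => ?_
    have hA : MeasurableSet {ξ : Site d → Noise | (c, ξ) ∈ T'} := measurable_prodMk_left hT'
    have hB : MeasurableSet {ξ : Site d → Noise | (shiftEnv z c, ξ) ∈ T'} :=
      measurable_prodMk_left hT'
    have hp := measurePreserving_shiftNoise τ z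
    have h1 : noiseField d τ ({ξ | (c, ξ) ∈ T'} ∩
        (fun ξ x => ξ (x + z)) ⁻¹' {ξ | (shiftEnv z c, ξ) ∈ T'}) = _ :=
      measure_inter_of_disjoint_coords (fun _ : Site d => noiseLaw τ) (K := K) hA
      (hp.measurable hB) (fun f g h => hK c f g h) ?_
    · have h2 := hp.measure_preimage hB.nullMeasurableSet
      refine h1.trans ?_
      show noiseField d τ _ * noiseField d τ _ = _
      rw [h2]
    · intro f g h
      refine hK _ _ _ fun x hx => h _ fun hxz => hz ?_
      exact Finset.mem_image₂.2 ⟨x + z, hxz, x, hx, by simp⟩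
  calc ∫⁻ c, α c ∂ν = modelLaw ν τ T := (Measure.prod_apply hT).symm
    _ ≤ modelLaw ν τ ((T' ∩ shiftModel z ⁻¹' T') ∪
          ((symmDiff T' T) ∪ shiftModel z ⁻¹' (symmDiff T' T))) := by
        refine measure_mono fun ω hω => ?_
        have hω' : shiftModel z ω ∈ T := (hinv z ω).2 hω
        by_cases h1 : ω ∈ T'
        · by_cases h2 : shiftModel z ω ∈ T'
          · exact .inl ⟨h1, h2⟩
          · exact .inr (.inr (.inr ⟨hω', h2⟩))
        · exact .inr (.inl (.inr ⟨hω, h1⟩))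
    _ ≤ ∫⁻ c, β c * β (shiftEnv z c) ∂ν + ((ε : ℝ≥0∞) / 4 + (ε : ℝ≥0∞) / 4) := by
        refine (measure_union_le _ _).trans (add_le_add hmix.le ((measure_union_le _ _).trans ?_))
        rw [hθ.measure_preimage (hT'.symmDiff hT).nullMeasurableSet]
        exact add_le_add hclose.le hclose.le
    _ ≤ ∫⁻ c, (α c * α c + δ (shiftEnv z c)) + δ c ∂ν + ((ε : ℝ≥0∞) / 4 + (ε : ℝ≥0∞) / 4) := by
        refine add_le_add (lintegral_mono fun c => ?_) le_rfl
        calc β c * β (shiftEnv z c) ≤ (α c + δ c) * β (shiftEnv z c) := mul_le_mul_left (hβ c) _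
          _ = α c * β (shiftEnv z c) + δ c * β (shiftEnv z c) := add_mul _ _ _
          _ ≤ α c * (α c + δ (shiftEnv z c)) + δ c * 1 := by
            refine add_le_add (mul_le_mul_right ?_ _) (mul_le_mul_right (hβ1 _) _)
            rw [← hαs c]
            exact hβ _
          _ ≤ (α c * α c + δ (shiftEnv z c)) + δ c := by
            rw [mul_add, mul_one]
            exact add_le_add (add_le_add le_rfl (mul_le_of_le_one_left zero_le (hα1 c))) le_rfl
    _ = ∫⁻ c, α c * α c ∂ν + (∫⁻ c, δ (shiftEnv z c) ∂ν + ∫⁻ c, δ c ∂ν +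
          ((ε : ℝ≥0∞) / 4 + (ε : ℝ≥0∞) / 4)) := by
        rw [lintegral_add_right _ hδm, lintegral_add_left (f := fun c => α c * α c) (hαm.mul hαm)]
        ring
    _ ≤ ∫⁻ c, α c * α c ∂ν + ε := by
        refine add_le_add le_rfl ?_
        calc _ ≤ (ε : ℝ≥0∞) / 4 + (ε : ℝ≥0∞) / 4 + ((ε : ℝ≥0∞) / 4 + (ε : ℝ≥0∞) / 4) :=
              add_le_add (add_le_add hδs hδ) le_rfl
          _ = 4 * ((ε : ℝ≥0∞) / 4) := by ring
          _ = ε := ENNReal.mul_div_cancel (by norm_num) (by norm_num)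

/-- If invariant events of the conductances are trivial, so are invariant events of the model. -/
theorem modelLaw_eq_zero_or_one (hd : 0 < d) (hν : ∀ z, ν.map (shiftEnv z) = ν)
    (herg : ∀ B : Set (Env d), MeasurableSet B → (∀ z c, shiftEnv z c ∈ B ↔ c ∈ B) →
      ν B = 0 ∨ ν B = 1)
    {T : Set (Model d)} (hT : MeasurableSet T) (hinv : ∀ z ω, shiftModel z ω ∈ T ↔ ω ∈ T) :
    (∀ᵐ ω ∂modelLaw ν τ, ω ∉ T) ∨ ∀ᵐ ω ∂modelLaw ν τ, ω ∈ T := by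
  set α : Env d → ℝ≥0∞ := fun c => noiseField d τ {ξ | (c, ξ) ∈ T} with hα
  have hαm : Measurable α := measurable_measure_prodMk_left hT
  have hα1 : ∀ c, α c ≤ 1 := fun c => prob_le_one
  have hαs : ∀ z c, α (shiftEnv z c) = α c := fun z c =>
    noiseField_section_shiftEnv τ hT hinv z c
  have hsq : ∀ᵐ c ∂ν, α c * α c = α c := by
    -- Together with the reverse inequality between the integrals, this pointwise bound forces `α² =
    -- α` almost surely: given the conductances, the invariant event is trivial.
    have hle : ∀ c, α c * α c ≤ α c := fun c => mul_le_of_le_one_left zero_le (hα1 c)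
    refine ae_eq_of_ae_le_of_lintegral_le (ae_of_all _ hle) ?_ hαm.aemeasurable
      (lintegral_section_le_sq hd hν hT hinv)
    refine ne_top_of_le_ne_top ENNReal.one_ne_top ?_
    calc ∫⁻ c, α c * α c ∂ν ≤ ∫⁻ _, 1 ∂ν := lintegral_mono fun c => (hle c).trans (hα1 c)
      _ = 1 := by simp
  have h01 : ∀ᵐ c ∂ν, α c = 0 ∨ α c = 1 := by
    filter_upwards [hsq] with c hc
    by_cases h0 : α c = 0
    · exact .inl h0
    · right
      have h2 : α c * α c = α c * 1 := by rw [hc, mul_one]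
      exact (ENNReal.mul_right_inj h0 (ne_top_of_le_ne_top ENNReal.one_ne_top (hα1 c))).1 h2
  have hBm : MeasurableSet {c | α c = 1} := hαm (measurableSet_singleton 1)
  rcases herg {c | α c = 1} hBm (fun z c => by
    show α (shiftEnv z c) = 1 ↔ α c = 1
    rw [hαs]) with h | h
  · left
    refine (Measure.ae_prod_iff_ae_ae hT.compl).2 ?_
    have hne : ∀ᵐ c ∂ν, ¬ α c = 1 := by
      rw [ae_iff]
      simpa using h
    filter_upwards [h01, hne] with c hc hc1
    have h0 : α c = 0 := hc.resolve_right hc1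
    rw [ae_iff]
    simpa [hα] using h0
  · right
    refine (Measure.ae_prod_iff_ae_ae hT).2 ?_
    filter_upwards [(mem_ae_iff_prob_eq_one hBm).2 h] with c hc
    exact (mem_ae_iff_prob_eq_one (measurable_prodMk_left hT)).2 hc

end JointErgodicity

/-! ### Conditional laws given the conductances -/

section ConditionalLaw

variable {Ω E : Type*} [MeasurableSpace Ω] [MeasurableSpace E] {P : Measure Ω}
  [IsProbabilityMeasure P] {c : Ω → E}

/-- A version of the conditional probability of `s` given `c` is determined by the probabilities
of `c ⁻¹' A ∩ s`. -/
theorem condExp_indicator_comap_iff (hc : Measurable c) {s : Set Ω} (hs : MeasurableSet s)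
    {g : E → ℝ≥0∞} (hg : Measurable g) (hg1 : ∀ e, g e ≤ 1) :
    (P⟦s | MeasurableSpace.comap c inferInstance⟧ =ᵐ[P] fun ω => (g (c ω)).toReal) ↔
      ∀ A, MeasurableSet A → P (c ⁻¹' A ∩ s) = ∫⁻ ω in c ⁻¹' A, g (c ω) ∂P := by
  have hm : MeasurableSpace.comap c inferInstance ≤ (inferInstance : MeasurableSpace Ω) :=
    hc.comap_le
  have hfin : ∀ e, g e ≠ ∞ := fun e => ne_top_of_le_ne_top ENNReal.one_ne_top (hg1 e)
  have hgc : Measurable fun ω => g (c ω) := hg.comp hc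
  have hint : Integrable (s.indicator fun _ => (1 : ℝ)) P :=
    (integrable_const 1).indicator hs
  have h1 : ∀ A, MeasurableSet A →
      ∫ ω in c ⁻¹' A, s.indicator (fun _ => (1 : ℝ)) ω ∂P = (P (c ⁻¹' A ∩ s)).toReal := by
    intro A hA
    rw [integral_indicator hs, integral_const, smul_eq_mul, mul_one, Measure.restrict_restrict hs,
      Measure.real, Measure.restrict_apply_univ, Set.inter_comm]
  have h2 : ∀ A, ∫ ω in c ⁻¹' A, (g (c ω)).toReal ∂P = (∫⁻ ω in c ⁻¹' A, g (c ω) ∂P).toReal :=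
    fun A => integral_toReal hgc.aemeasurable (.of_forall fun ω => (hfin _).lt_top)
  have h3 : ∀ A, ∫⁻ ω in c ⁻¹' A, g (c ω) ∂P ≠ ∞ := fun A => by
    refine ne_top_of_le_ne_top (measure_ne_top P (c ⁻¹' A)) ?_
    calc ∫⁻ ω in c ⁻¹' A, g (c ω) ∂P ≤ ∫⁻ _ in c ⁻¹' A, 1 ∂P := lintegral_mono fun ω => hg1 _
      _ = P (c ⁻¹' A) := by simp
  constructor
  · intro h A hA
    rw [← ENNReal.toReal_eq_toReal_iff' (measure_ne_top _ _) (h3 A), ← h1 A hA, ← h2 A,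
      ← setIntegral_condExp hm hint ⟨A, hA, rfl⟩]
    exact integral_congr_ae (ae_restrict_of_ae h)
  · intro h
    have hgi : Integrable (fun ω => (g (c ω)).toReal) P := by
      refine integrable_toReal_of_lintegral_ne_top hgc.aemeasurable ?_
      simpa using h3 Set.univ
    refine (ae_eq_condExp_of_forall_setIntegral_eq hm hint (fun _ _ _ => hgi.integrableOn)
      ?_ ?_).symm
    · rintro _ ⟨A, hA, rfl⟩ _
      rw [h1 A hA, h2 A, h A hA]
    · have : Measurable[MeasurableSpace.comap c inferInstance] fun ω => (g (c ω)).toReal :=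
        hg.ennreal_toReal.comp (comap_measurable c)
      exact this.stronglyMeasurable.aestronglyMeasurable

end ConditionalLaw

/-- Two finite measures on a path space agree if they agree on the sets of all paths with a given
initial part. -/
theorem ext_of_initial_part {V : Type*} [Countable V] [MeasurableSpace V]
    [MeasurableSingletonClass V] {μ ν : Measure (ℕ → V)} [IsFiniteMeasure μ] [IsFiniteMeasure ν]
    (h : ∀ (m : ℕ) (p : ℕ → V), μ {y | ∀ j ≤ m, y j = p j} = ν {y | ∀ j ≤ m, y j = p j}) :
    μ = ν := by
  have hproj : IsProjectiveMeasureFamily (α := fun _ : ℕ => V)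
      fun I : Finset ℕ => ν.map I.restrict := by
    intro I J hJI
    rw [Measure.map_map (by fun_prop) (by fun_prop), Finset.restrict₂_comp_restrict]
  have hμ : IsProjectiveLimit μ fun I : Finset ℕ => ν.map I.restrict := by
    rw [isProjectiveLimit_nat_iff hproj]
    intro n
    refine Measure.ext_of_singleton fun a => ?_
    rw [Measure.map_apply (by fun_prop) (measurableSet_singleton a),
      Measure.map_apply (by fun_prop) (measurableSet_singleton a)]
    -- The values of `p` beyond `n` are arbitrary; only its initial part `a` enters.
    let p : ℕ → V := fun j => if hj : j ∈ Finset.Iic n then a ⟨j, hj⟩ else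
      a ⟨0, Finset.mem_Iic.2 (Nat.zero_le _)⟩
    have hset : (Preorder.frestrictLe (π := fun _ : ℕ => V) n) ⁻¹' {a} =
        {y | ∀ j ≤ n, y j = p j} := by
      ext y
      simp only [Set.mem_preimage, Set.mem_singleton_iff, funext_iff, Subtype.forall,
        Set.mem_ofPred_eq]
      refine forall_congr' fun j => ?_
      by_cases hj : j ≤ n
      · simp [p, hj]
      · simp [hj]
    have hset' : (Finset.restrict (π := fun _ : ℕ => V) (Finset.Iic n)) ⁻¹' {a} =
        {y | ∀ j ≤ n, y j = p j} := hset
    rw [hset, hset', h]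
  exact hμ.unique fun I => rfl

/-! ### Joint law of the conductances and conditionally independent walks -/

section Walks

variable {d : ℕ} {Ω : Type*} [MeasurableSpace Ω] {P : Measure Ω} [IsProbabilityMeasure P]
  {c : Ω → Env d}

theorem measurable_walk_path (x : Site d) :
    Measurable fun p : Env d × (ℕ → unitInterval) => walk p.1 x p.2 :=
  measurable_pi_iff.2 fun j => measurable_walk x j

/-- A walk among the conductances `c` has the conditional law of the walk driven by uniform
variables. -/
theorem IsWalkGiven.measure_inter (hc : Measurable c) {x : Site d} {Y : Ω → ℕ → Site d}
    (hY : Measurable Y) (h : IsWalkGiven P c x Y) {A : Set (Env d)} (hA : MeasurableSet A)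
    {B : Set (ℕ → Site d)} (hB : MeasurableSet B) :
    P (c ⁻¹' A ∩ Y ⁻¹' B) = ∫⁻ ω in c ⁻¹' A, driverLaw {u | walk (c ω) x u ∈ B} ∂P := by
  have hw : Measurable fun p : Ω × (ℕ → unitInterval) => walk (c p.1) x p.2 :=
    (measurable_walk_path x).comp ((hc.comp measurable_fst).prodMk measurable_snd)
  have hcyl : ∀ (m : ℕ) (p : ℕ → Site d), MeasurableSet {y : ℕ → Site d | ∀ j ≤ m, y j = p j} := by
    intro m p
    have : {y : ℕ → Site d | ∀ j ≤ m, y j = p j} = ⋂ j ∈ Set.Iic m, (fun y => y j) ⁻¹' {p j} := by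
      ext y; simp
    rw [this]
    exact MeasurableSet.biInter (Set.to_countable _) fun j _ =>
      measurable_pi_apply j (measurableSet_singleton _)
  have happly : ∀ B, MeasurableSet B →
      (((P.restrict (c ⁻¹' A)).prod driverLaw).map fun p => walk (c p.1) x p.2) B =
        ∫⁻ ω in c ⁻¹' A, driverLaw {u | walk (c ω) x u ∈ B} ∂P := by
    intro B hB
    rw [Measure.map_apply hw hB, Measure.prod_apply (hw hB)]
    rfl
  -- For fixed `A` both sides are finite measures in `B`, so it suffices to compare initial parts of
  -- paths, where the walk hypothesis gives the conditional probabilities.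
  have hlaw : (P.restrict (c ⁻¹' A)).map Y =
      ((P.restrict (c ⁻¹' A)).prod driverLaw).map fun p => walk (c p.1) x p.2 := by
    have : IsFiniteMeasure (((P.restrict (c ⁻¹' A)).prod driverLaw).map
        fun p => walk (c p.1) x p.2) := Measure.isFiniteMeasure_map _ _
    refine ext_of_initial_part fun m p => ?_
    rw [happly _ (hcyl m p), Measure.map_apply hY (hcyl m p),
      Measure.restrict_apply (hY (hcyl m p)), Set.inter_comm]
    have hgm : Measurable fun e : Env d => driverLaw {u | ∀ j ≤ m, walk e x u j = p j} :=
      measurable_measure_prodMk_left (measurable_walk_path x (hcyl m p))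
    refine (condExp_indicator_comap_iff hc (hY (hcyl m p)) hgm (fun e => prob_le_one)).1 ?_ A hA
    refine (h m p).trans (.of_forall fun ω => ?_)
    show _ = (driverLaw {u | ∀ j ≤ m, walk (c ω) x u j = p j}).toReal
    rw [driverLaw, infinitePi_walk_eq, ENNReal.toReal_mul, ENNReal.toReal_prod]
    simp_rw [ENNReal.toReal_ofReal (transition_nonneg _ _ _)]
    split_ifs <;> simp
  rw [← happly B hB, ← hlaw, Measure.map_apply hY hB, Measure.restrict_apply (hY hB),
    Set.inter_comm]

/-- The uniform variables driving a family of walks indexed by `ι`. -/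
def driversLaw (ι : Type*) : Measure (ι → ℕ → unitInterval) := Measure.infinitePi fun _ => driverLaw

instance (ι : Type*) : IsProbabilityMeasure (driversLaw ι) := by
  unfold driversLaw
  infer_instance

/-- The joint law of the conductances and a family of conditionally independent walks. -/
theorem map_prodMk_walks {ι : Type*} (hc : Measurable c) (x : ι → Site d)
    {X : ι → Ω → ℕ → Site d} (hX : ∀ f, Measurable (X f)) (hwalk : ∀ f, IsWalkGiven P c (x f) (X f))
    (hind : CondIndepGiven P (MeasurableSpace.comap c inferInstance) X) :
    P.map (fun ω => (c ω, fun f => X f ω)) =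
      ((P.map c).prod (driversLaw ι)).map fun p => (p.1, fun f => walk p.1 (x f) (p.2 f)) := by
  have hXm : Measurable fun ω f => X f ω := measurable_pi_iff.2 hX
  have hw : Measurable fun p : Env d × (ι → ℕ → unitInterval) =>
      fun f => walk p.1 (x f) (p.2 f) :=
    measurable_pi_iff.2 fun f => (measurable_walk_path (x f)).comp
      (measurable_fst.prodMk ((measurable_pi_apply f).comp measurable_snd))
  have : IsProbabilityMeasure (P.map c) := Measure.isProbabilityMeasure_map hc.aemeasurable
  have : IsFiniteMeasure (P.map (fun ω => (c ω, fun f => X f ω))) := Measure.isFiniteMeasure_map _ _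
  refine Measure.ext_prod fun {A B} hA hB => ?_
  rw [Measure.map_apply (hc.prodMk hXm) (hA.prod hB),
    Measure.map_apply (measurable_fst.prodMk hw) (hA.prod hB)]
  have hl : (fun ω => (c ω, fun f => X f ω)) ⁻¹' (A ×ˢ B) =
      (fun ω f => X f ω) ⁻¹' B ∩ c ⁻¹' A := by
    ext ω; simp [and_comm]
  have hr : (fun p : Env d × (ι → ℕ → unitInterval) => (p.1, fun f => walk p.1 (x f) (p.2 f))) ⁻¹'
      (A ×ˢ B) = (fun p : Env d × (ι → ℕ → unitInterval) => fun f => walk p.1 (x f) (p.2 f)) ⁻¹' B ∩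
        A ×ˢ Set.univ := by
    ext ω; simp [and_comm]
  have hAc : MeasurableSet (c ⁻¹' A) := hc hA
  rw [hl, hr, ← Measure.restrict_apply (hXm hB), ← Measure.restrict_apply (hw hB),
    ← Measure.map_apply hXm hB, ← Measure.map_apply hw hB]
  have : IsFiniteMeasure ((P.restrict (c ⁻¹' A)).map (fun ω f => X f ω)) :=
    Measure.isFiniteMeasure_map _ _
  refine congrArg (fun μ : Measure (ι → ℕ → Site d) => μ B) ?_
  -- On square cylinders conditional independence turns the probability into an integral of a
  -- product over the walks; the driven walks give the same product because their drivers are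
  -- independent.
  have hsq : ∀ (I : Finset ι) (t : ι → Set (ℕ → Site d)), (∀ f, MeasurableSet (t f)) →
      (P.restrict (c ⁻¹' A)).map (fun ω f => X f ω) ((I : Set ι).pi t) =
      ((((P.map c).prod (driversLaw ι)).restrict (A ×ˢ Set.univ)).map
        fun p => fun f => walk p.1 (x f) (p.2 f)) ((I : Set ι).pi t) := by
    intro I t ht
    have hpi : MeasurableSet ((I : Set ι).pi t) :=
      MeasurableSet.pi I.countable_toSet fun f _ => ht f
    rw [Measure.map_apply hXm hpi, Measure.map_apply hw hpi, Measure.restrict_apply (hXm hpi),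
      Measure.restrict_apply (hw hpi)]
    have hg : ∀ f, Measurable fun e : Env d => driverLaw {u | walk e (x f) u ∈ t f} := fun f =>
      measurable_measure_prodMk_left (measurable_walk_path (x f) (ht f))
    have hP : P (c ⁻¹' A ∩ ⋂ f ∈ I, X f ⁻¹' t f) =
        ∫⁻ ω in c ⁻¹' A, ∏ f ∈ I, driverLaw {u | walk (c ω) (x f) u ∈ t f} ∂P := by
      refine (condExp_indicator_comap_iff (g := fun e => ∏ f ∈ I,
        driverLaw {u | walk e (x f) u ∈ t f}) hc ?_ (Finset.measurable_prod _ fun f _ => hg f)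
        (fun e => Finset.prod_le_one' fun f _ => prob_le_one)).1 ?_ A hA
      · exact Finset.measurableSet_biInter _ fun f _ => hX f (ht f)
      · have hone : ∀ f, P⟦X f ⁻¹' t f | MeasurableSpace.comap c inferInstance⟧ =ᵐ[P]
            fun ω => (driverLaw {u | walk (c ω) (x f) u ∈ t f}).toReal := fun f =>
          (condExp_indicator_comap_iff hc (hX f (ht f)) (hg f) fun e => prob_le_one).2
            fun A hA => (hwalk f).measure_inter hc (hX f) hA (ht f)
        have hall : ∀ᵐ ω ∂P, ∀ f ∈ I,
            (P⟦X f ⁻¹' t f | MeasurableSpace.comap c inferInstance⟧) ω =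
              (driverLaw {u | walk (c ω) (x f) u ∈ t f}).toReal :=
          (Finset.eventually_all I).2 fun f _ => hone f
        filter_upwards [hind I t fun f _ => ht f, hall] with ω h1 h2
        rw [h1, ENNReal.toReal_prod]
        exact Finset.prod_congr rfl fun f hf => h2 f hf
    have hl : (fun ω f => X f ω) ⁻¹' ((I : Set ι).pi t) ∩ c ⁻¹' A =
        c ⁻¹' A ∩ ⋂ f ∈ I, X f ⁻¹' t f := by
      ext ω; simp [Set.mem_pi, and_comm]
    rw [hl, hP, Measure.prod_apply ((hw hpi).inter (hA.prod MeasurableSet.univ))]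
    have hslice : ∀ e : Env d, driversLaw ι (Prod.mk e ⁻¹'
        ((fun p : Env d × (ι → ℕ → unitInterval) => fun f => walk p.1 (x f) (p.2 f)) ⁻¹'
          ((I : Set ι).pi t) ∩ A ×ˢ Set.univ)) =
        A.indicator (fun e => ∏ f ∈ I, driverLaw {u | walk e (x f) u ∈ t f}) e := by
      intro e
      by_cases he : e ∈ A
      · rw [Set.indicator_of_mem he]
        have : Prod.mk e ⁻¹'
            ((fun p : Env d × (ι → ℕ → unitInterval) => fun f => walk p.1 (x f) (p.2 f)) ⁻¹'
              ((I : Set ι).pi t) ∩ A ×ˢ Set.univ) =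
            (I : Set ι).pi fun f => {u | walk e (x f) u ∈ t f} := by
          ext U; simp [Set.mem_pi, he]
        rw [this, driversLaw, Measure.infinitePi_pi]
        intro f _
        exact ((measurable_walk_path (x f)).comp measurable_prodMk_left) (ht f)
      · rw [Set.indicator_of_notMem he]
        have : Prod.mk e ⁻¹'
            ((fun p : Env d × (ι → ℕ → unitInterval) => fun f => walk p.1 (x f) (p.2 f)) ⁻¹'
              ((I : Set ι).pi t) ∩ A ×ˢ Set.univ) = ∅ := by
          ext U; simp [he]
        rw [this, measure_empty]
    simp_rw [hslice]
    rw [lintegral_indicator hA, Measure.restrict_map hc hA,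
      lintegral_map (Finset.measurable_prod _ fun f _ => hg f) hc]
  refine ext_of_generate_finite _ generateFrom_squareCylinders.symm
    (isPiSystem_squareCylinders (fun _ => MeasurableSpace.isPiSystem_measurableSet) (by simp)) ?_ ?_
  · rintro _ ⟨I, t, ht, rfl⟩
    exact hsq I t fun f => ht f (Set.mem_univ f)
  · simpa using hsq ∅ (fun _ => Set.univ) fun _ => MeasurableSet.univ

end Walks

/-! ### The law of the frog model -/

/-- The whole space is a square cylinder. -/
def spanningSquareCylinders {ι : Type*} {α : ι → Type*} [∀ i, MeasurableSpace (α i)]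
    (μ : Measure (∀ i, α i)) [IsFiniteMeasure μ] :
    μ.FiniteSpanningSetsIn (squareCylinders fun i => {s : Set (α i) | MeasurableSet s}) :=
  ⟨fun _ => Set.univ, fun _ => ⟨∅, fun _ => Set.univ, by simp, by simp⟩,
    fun _ => measure_lt_top _ _, Set.iUnion_const _⟩

theorem infinitePi_map_unzip {ι : Type*} {α β : ι → Type*} [∀ i, MeasurableSpace (α i)]
    [∀ i, MeasurableSpace (β i)] (μ : ∀ i, Measure (α i)) (ν : ∀ i, Measure (β i))
    [∀ i, IsProbabilityMeasure (μ i)] [∀ i, IsProbabilityMeasure (ν i)] :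
    (Measure.infinitePi fun i => (μ i).prod (ν i)).map
      (fun z => (fun i => (z i).1, fun i => (z i).2)) =
    (Measure.infinitePi μ).prod (Measure.infinitePi ν) := by
  classical
  refine (Measure.prod_eq_generateFrom generateFrom_squareCylinders generateFrom_squareCylinders
    (isPiSystem_squareCylinders (fun _ => MeasurableSpace.isPiSystem_measurableSet) (by simp))
    (isPiSystem_squareCylinders (fun _ => MeasurableSpace.isPiSystem_measurableSet) (by simp))
    (spanningSquareCylinders _)
    (spanningSquareCylinders _) ?_).symm
  rintro _ ⟨I, s, hs, rfl⟩ _ ⟨J, t, ht, rfl⟩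
  have hs' : ∀ i, MeasurableSet (s i) := fun i => hs i (Set.mem_univ i)
  have ht' : ∀ i, MeasurableSet (t i) := fun i => ht i (Set.mem_univ i)
  rw [Measure.map_apply (by fun_prop) ((MeasurableSet.pi I.countable_toSet fun i _ => hs' i).prod
    (MeasurableSet.pi J.countable_toSet fun i _ => ht' i))]
  have hset : (fun z : ∀ i, α i × β i => ((fun i => (z i).1, fun i => (z i).2) :
      (∀ i, α i) × ∀ i, β i)) ⁻¹' ((I : Set ι).pi s ×ˢ (J : Set ι).pi t) =
      ((I ∪ J : Finset ι) : Set ι).pi fun i =>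
        (if i ∈ I then s i else Set.univ) ×ˢ (if i ∈ J then t i else Set.univ) := by
    ext z
    simp only [Set.mem_preimage, Set.mem_prod, Set.mem_pi, Finset.coe_union, Set.mem_union,
      Finset.mem_coe]
    constructor
    · rintro ⟨h1, h2⟩ i -
      constructor <;> split_ifs with hi
      exacts [h1 i hi, Set.mem_univ _, h2 i hi, Set.mem_univ _]
    · intro h
      refine ⟨fun i hi => ?_, fun i hi => ?_⟩
      · simpa [hi] using (h i (.inl hi)).1
      · simpa [hi] using (h i (.inr hi)).2
  rw [hset, Measure.infinitePi_pi, Measure.infinitePi_pi _ fun i _ => hs' i,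
    Measure.infinitePi_pi _ fun i _ => ht' i]
  · simp_rw [Measure.prod_prod]
    rw [Finset.prod_mul_distrib]
    congr 1
    · rw [← Finset.prod_subset Finset.subset_union_left fun i _ hi => by simp [hi]]
      exact Finset.prod_congr rfl fun i hi => by rw [if_pos hi]
    · rw [← Finset.prod_subset Finset.subset_union_right fun i _ hi => by simp [hi]]
      exact Finset.prod_congr rfl fun i hi => by rw [if_pos hi]
  · intro i _
    refine MeasurableSet.prod ?_ ?_ <;> split_ifs
    exacts [hs' i, MeasurableSet.univ, ht' i, MeasurableSet.univ]

section Law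

variable {d : ℕ}

/-- The uniform variables driving the frogs. -/
def frogDrivers (ξ : Site d → Noise) (f : Site d × ℕ+) (k : ℕ) : unitInterval := (ξ f.1).2 (f.2, k)

/-- Frog numbers and uniform variables are unzipped, and the uniforms, grouped by site, are
regrouped by frog. Uncurrying, permuting indices and currying again all preserve the product law. -/
theorem noiseField_map_drivers (τ : Measure ℕ) [IsProbabilityMeasure τ] :
    (noiseField d τ).map (fun ξ => (frogCount ξ, frogDrivers ξ)) =
      (Measure.infinitePi fun _ : Site d => τ).prod (driversLaw (Site d × ℕ+)) := by
  have hd : ((Measure.infinitePi fun _ : Site d => Measure.infinitePi fun _ : ℕ+ × ℕ =>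
      (volume : Measure unitInterval)).map
      fun V (f : Site d × ℕ+) (k : ℕ) => V f.1 (f.2, k)) = driversLaw (Site d × ℕ+) := by
    have h1 := Measure.infinitePi_map_curry_symm (ι := Site d) (κ := ℕ+ × ℕ)
      fun _ _ => (volume : Measure unitInterval)
    have h2 := Measure.map_infinitePi_infinitePi_of_inj
      (P := fun _ : Site d × (ℕ+ × ℕ) => (volume : Measure unitInterval))
      (f := fun p : (Site d × ℕ+) × ℕ => (p.1.1, (p.1.2, p.2))) (by
        rintro ⟨⟨_, _⟩, _⟩ ⟨⟨_, _⟩, _⟩ h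
        simp_all)
    have h3 := Measure.infinitePi_map_curry (ι := Site d × ℕ+) (κ := ℕ)
      fun _ _ => (volume : Measure unitInterval)
    rw [← h2, ← h1, Measure.map_map (by fun_prop) (by fun_prop),
      Measure.map_map (by fun_prop) (by fun_prop)] at h3
    exact h3
  rw [← hd]
  nth_rw 1 [← Measure.map_id (μ := Measure.infinitePi fun _ : Site d => τ)]
  rw [Measure.map_prod_map _ _ measurable_id (by fun_prop), ← infinitePi_map_unzip,
    Measure.map_map (by fun_prop) (by fun_prop)]
  rfl

variable {Ω : Type*} [MeasurableSpace Ω] {P : Measure Ω} [IsProbabilityMeasure P]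

theorem modelLaw_map_drivers (ν : Measure (Env d)) [IsProbabilityMeasure ν] (τ : Measure ℕ)
    [IsProbabilityMeasure τ] :
    (modelLaw ν τ).map (fun ω => (frogCount ω.2, (ω.1, frogDrivers ω.2))) =
      (Measure.infinitePi fun _ : Site d => τ).prod (ν.prod (driversLaw (Site d × ℕ+))) := by
  have hm : Measurable fun ξ : Site d → Noise => (frogCount ξ, frogDrivers ξ) := by
    unfold frogCount frogDrivers
    fun_prop
  have hm' : Measurable fun ω : Model d => (frogCount ω.2, (ω.1, frogDrivers ω.2)) :=
    (measurable_fst.comp (hm.comp measurable_snd)).prodMk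
      (measurable_fst.prodMk (measurable_snd.comp (hm.comp measurable_snd)))
  have : IsFiniteMeasure
      ((modelLaw ν τ).map (fun ω => (frogCount ω.2, (ω.1, frogDrivers ω.2)))) :=
    Measure.isFiniteMeasure_map _ _
  refine Measure.ext_prod₃ fun {s t u} hs ht hu => ?_
  rw [Measure.map_apply hm' (hs.prod (ht.prod hu)), Measure.prod_prod, Measure.prod_prod]
  have : (fun ω : Model d => (frogCount ω.2, (ω.1, frogDrivers ω.2))) ⁻¹' (s ×ˢ t ×ˢ u) =
      t ×ˢ ((fun ξ => (frogCount ξ, frogDrivers ξ)) ⁻¹' (s ×ˢ u)) := by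
    ext ω
    simp only [Set.mem_preimage, Set.mem_prod]
    tauto
  rw [this, modelLaw, Measure.prod_prod, ← Measure.map_apply hm (hs.prod hu),
    noiseField_map_drivers, Measure.prod_prod]
  ring

/-- The conductances, frog numbers and trajectories have the law of the model driven by uniform
variables. -/
theorem map_eq_modelLaw_map {c : Ω → Env d} (hc : Measurable c) {η : Ω → Site d → ℕ}
    (hη : Measurable η) {S : Ω → ℕ → Site d → ℕ+ → Site d} (hS : Measurable S)
    (hwalk : ∀ (x : Site d) (i : ℕ+), IsWalkGiven P c x (fun ω j => S ω j x i))
    (hindep : CondIndepGiven P (MeasurableSpace.comap c inferInstance)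
      (fun (f : Site d × ℕ+) (ω : Ω) (j : ℕ) => S ω j f.1 f.2))
    (hηindep : iIndepFun (fun (x : Site d) (ω : Ω) => η ω x) P)
    (hηident : ∀ x : Site d, IdentDistrib (fun ω => η ω x) (fun ω => η ω 0) P P)
    (hηcS : IndepFun η (fun ω => (c ω, S ω)) P)
    [IsProbabilityMeasure (P.map c)] [IsProbabilityMeasure (P.map fun ω => η ω 0)] :
    P.map (fun ω => (c ω, (η ω, S ω))) =
      (modelLaw (P.map c) (P.map fun ω => η ω 0)).map
        fun ω => (ω.1, (frogCount ω.2, frogPath ω.1 ω.2)) := by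
  have hX : ∀ f : Site d × ℕ+, Measurable fun ω (j : ℕ) => S ω j f.1 f.2 := fun f => by fun_prop
  have hηlaw : P.map η = Measure.infinitePi fun _ : Site d => P.map fun ω => η ω 0 := by
    have h := hηindep.map_fun_eq_infinitePi_map fun x => by fun_prop
    rw [show (fun ω x => η ω x) = η from rfl] at h
    rw [h]
    have : ∀ x, P.map (fun ω => η ω x) = P.map fun ω => η ω 0 := fun x => (hηident x).map_eq
    simp_rw [this]
  have hcX : Measurable fun ω => (c ω, fun (f : Site d × ℕ+) (j : ℕ) => S ω j f.1 f.2) :=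
    hc.prodMk (measurable_pi_iff.2 hX)
  have hind : IndepFun η (fun ω => (c ω, fun (f : Site d × ℕ+) (j : ℕ) => S ω j f.1 f.2)) P :=
    hηcS.comp (φ := id) (ψ := fun p : Env d × (ℕ → Site d → ℕ+ → Site d) =>
      (p.1, fun (f : Site d × ℕ+) (j : ℕ) => p.2 j f.1 f.2)) measurable_id (by fun_prop)
  have hjoint := (indepFun_iff_map_prod_eq_prod_map_map hη.aemeasurable hcX.aemeasurable).1 hind
  have hw : Measurable fun p : Env d × (Site d × ℕ+ → ℕ → unitInterval) =>
      (p.1, fun f : Site d × ℕ+ => walk p.1 f.1 (p.2 f)) :=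
    measurable_fst.prodMk (measurable_pi_iff.2 fun f => (measurable_walk_path f.1).comp
      (measurable_fst.prodMk ((measurable_pi_apply f).comp measurable_snd)))
  have hm : Measurable fun ω : Model d => (frogCount ω.2, (ω.1, frogDrivers ω.2)) := by
    unfold frogCount frogDrivers
    fun_prop
  have hwalks := map_prodMk_walks hc (fun f : Site d × ℕ+ => f.1) hX (fun f => hwalk f.1 f.2) hindep
  have hlaw : P.map (fun ω => (η ω, (c ω, fun (f : Site d × ℕ+) (j : ℕ) => S ω j f.1 f.2))) =
      (modelLaw (P.map c) (P.map fun ω => η ω 0)).map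
        (Prod.map id (fun p : Env d × (Site d × ℕ+ → ℕ → unitInterval) =>
          (p.1, fun f : Site d × ℕ+ => walk p.1 f.1 (p.2 f))) ∘
          fun ω => (frogCount ω.2, (ω.1, frogDrivers ω.2))) := by
    rw [← Measure.map_map (measurable_id.prodMap hw) hm, modelLaw_map_drivers,
      ← Measure.map_prod_map _ _ measurable_id hw, Measure.map_id, ← hηlaw, ← hwalks]
    exact hjoint
  let H : (Site d → ℕ) × (Env d × (Site d × ℕ+ → ℕ → Site d)) →
      Env d × ((Site d → ℕ) × (ℕ → Site d → ℕ+ → Site d)) := fun q =>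
    (q.2.1, (q.1, fun j x i => q.2.2 (x, i) j))
  have hH : Measurable H := by fun_prop
  have hmap := congrArg (Measure.map H) hlaw
  rw [Measure.map_map hH (hη.prodMk hcX),
    Measure.map_map hH ((measurable_id.prodMap hw).comp hm)] at hmap
  exact hmap

end Law

theorem measurableSet_cluster_unique {d : ℕ} : MeasurableSet {c : Env d | ∀ x y : Site d,
    (cluster c x).Infinite → (cluster c y).Infinite → cluster c x = cluster c y} := by
  simp only [Set.ext_iff]
  refine measurableSet_setOfPred.2 (Measurable.forall fun x => Measurable.forall fun y =>
    (measurableSet_setOfPred.1 (measurableSet_cluster_infinite x)).imp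
      ((measurableSet_setOfPred.1 (measurableSet_cluster_infinite y)).imp
        (Measurable.forall fun z => ?_)))
  exact (measurableSet_setOfPred.1 (measurableSet_mem_cluster x z)).iff
    (measurableSet_setOfPred.1 (measurableSet_mem_cluster y z))

end FrogRCM

end

/-! ### Transfer from the canonical model and conclusion -/

theorem theorem2 {d : ℕ} (hd : 2 ≤ d)
    {Ω : Type*} [MeasurableSpace Ω] (P : Measure Ω) [IsProbabilityMeasure P]
    -- the conductances, the numbers of frogs, and the frog trajectories
    (c : Ω → FrogRCM.Env d) (hc : Measurable c)
    (η : Ω → FrogRCM.Site d → ℕ) (hη : Measurable η)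
    (S : Ω → ℕ → FrogRCM.Site d → ℕ+ → FrogRCM.Site d) (hS : Measurable S)
    -- assumptions on the conductances
    (hstat : FrogRCM.Stationary P c)
    (herg : FrogRCM.ErgodicShifts P c)
    (hq : ∫⁻ ω, (FrogRCM.totalConductance (c ω) 0 : ℝ≥0∞) ∂P < ∞)
    (huniq : ∀ᵐ ω ∂P, ∀ x y : FrogRCM.Site d,
      (FrogRCM.cluster (c ω) x).Infinite → (FrogRCM.cluster (c ω) y).Infinite →
        FrogRCM.cluster (c ω) x = FrogRCM.cluster (c ω) y)
    -- given the conductances, the frogs are independent walks among the conductances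
    (hwalk : ∀ (x : FrogRCM.Site d) (i : ℕ+),
      FrogRCM.IsWalkGiven P c x (fun ω j => S ω j x i))
    (hindep : FrogRCM.CondIndepGiven P (MeasurableSpace.comap c inferInstance)
      (fun (f : FrogRCM.Site d × ℕ+) (ω : Ω) (j : ℕ) => S ω j f.1 f.2))
    -- the numbers of frogs are i.i.d. and independent of conductances and trajectories
    (hηindep : iIndepFun (fun (x : FrogRCM.Site d) (ω : Ω) => η ω x) P)
    (hηident : ∀ x : FrogRCM.Site d, IdentDistrib (fun ω => η ω x) (fun ω => η ω 0) P P)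
    (hηcS : IndepFun η (fun ω => (c ω, S ω)) P) :
    (∀ᵐ ω ∂P, ∀ x : FrogRCM.Site d, FrogRCM.Transient (η ω) (S ω) x) ∨
    (∀ᵐ ω ∂P, ∀ x : FrogRCM.Site d, 1 ≤ η ω x → (FrogRCM.cluster (c ω) x).Infinite →
      FrogRCM.Recurrent (η ω) (S ω) x) := by
  have hν : ∀ z, (P.map c).map (FrogRCM.shiftEnv z) = P.map c := fun z => by
    rw [Measure.map_map (FrogRCM.measurable_shiftEnv z) hc]
    exact hstat z
  have hη0 : Measurable fun ω => η ω 0 := by fun_prop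
  have : IsProbabilityMeasure (P.map c) := Measure.isProbabilityMeasure_map hc.aemeasurable
  have : IsProbabilityMeasure (P.map fun ω => η ω 0) :=
    Measure.isProbabilityMeasure_map hη0.aemeasurable
  have hlaw := FrogRCM.map_eq_modelLaw_map hc hη hS hwalk hindep hηindep hηident hηcS
  have hΩ : Measurable fun ω => (c ω, (η ω, S ω)) := hc.prodMk (hη.prodMk hS)
  have hM : Measurable fun ω : FrogRCM.Model d =>
      (ω.1, (FrogRCM.frogCount ω.2, FrogRCM.frogPath ω.1 ω.2)) :=
    measurable_fst.prodMk (FrogRCM.measurable_frogCount.prodMk FrogRCM.measurable_frogPath)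
  have hrec : ∀ x, MeasurableSet
      {q : FrogRCM.Env d × ((FrogRCM.Site d → ℕ) × (ℕ → FrogRCM.Site d → ℕ+ → FrogRCM.Site d)) |
        FrogRCM.Recurrent q.2.1 q.2.2 x} := fun x =>
    FrogRCM.measurableSet_recurrent (by fun_prop) (by fun_prop) x
  -- Recurrence is a measurable function of conductances, frog numbers and trajectories, whose joint
  -- law is the canonical one, so almost sure statements carry over.
  have transfer : ∀ {p : FrogRCM.Env d ×
      ((FrogRCM.Site d → ℕ) × (ℕ → FrogRCM.Site d → ℕ+ → FrogRCM.Site d)) → Prop},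
      MeasurableSet {q | p q} →
      (∀ᵐ ω ∂FrogRCM.modelLaw (P.map c) (P.map fun ω => η ω 0),
        p (ω.1, (FrogRCM.frogCount ω.2, FrogRCM.frogPath ω.1 ω.2))) →
      ∀ᵐ ω ∂P, p (c ω, (η ω, S ω)) := by
    intro p hp h
    rwa [← ae_map_iff hM.aemeasurable hp, ← hlaw, ae_map_iff hΩ.aemeasurable hp] at h
  have hT : MeasurableSet {ω : FrogRCM.Model d | ∃ v, FrogRCM.Rec ω.1 ω.2 v} := by
    rw [Set.ofPred_exists]
    exact MeasurableSet.iUnion FrogRCM.measurableSet_rec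
  have hinv : ∀ z (ω : FrogRCM.Model d),
      FrogRCM.shiftModel z ω ∈ {ω : FrogRCM.Model d | ∃ v, FrogRCM.Rec ω.1 ω.2 v} ↔
        ω ∈ {ω : FrogRCM.Model d | ∃ v, FrogRCM.Rec ω.1 ω.2 v} := by
    intro z ω
    simp only [Set.mem_ofPred_eq, FrogRCM.rec_shiftModel]
    exact (Equiv.addRight z).exists_congr_left.trans (by simp)
  have herg' : ∀ B : Set (FrogRCM.Env d), MeasurableSet B →
      (∀ z e, FrogRCM.shiftEnv z e ∈ B ↔ e ∈ B) → P.map c B = 0 ∨ P.map c B = 1 := by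
    intro B hB hBinv
    rw [Measure.map_apply hc hB]
    -- A strictly invariant `B` serves as its own witness: `c ⁻¹' B` equals each of the shifted
    -- events, with no exceptional null set.
    refine herg _ (hc hB) B hB fun z => ?_
    simp only [hBinv]
    rfl
  rcases FrogRCM.modelLaw_eq_zero_or_one (τ := P.map fun ω => η ω 0) (by omega) hν herg' hT hinv
    with h | h
  · left
    refine transfer (p := fun q => ∀ x, FrogRCM.Transient q.2.1 q.2.2 x) ?_ ?_
    · rw [Set.ofPred_forall]
      exact MeasurableSet.iInter fun x => (hrec x).compl
    · filter_upwards [h] with ω hω x hx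
      exact hω ⟨x, hx⟩
  · right
    have hq' : ∫⁻ e, (FrogRCM.totalConductance e 0 : ℝ≥0∞) ∂(P.map c) < ∞ := by
      rwa [lintegral_map (by fun_prop) hc]
    have key := FrogRCM.ae_rec_of_ae_exists_rec hν hq'
      ((ae_map_iff hc.aemeasurable FrogRCM.measurableSet_cluster_unique).2 huniq) h
    refine transfer (p := fun q => ∀ x, 1 ≤ q.2.1 x → (FrogRCM.cluster q.1 x).Infinite →
      FrogRCM.Recurrent q.2.1 q.2.2 x) ?_ key
    refine measurableSet_setOfPred.2 (Measurable.forall fun x => Measurable.imp ?_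
      (Measurable.imp ?_ ?_))
    · exact measurableSet_setOfPred.1 (measurableSet_le measurable_const (by fun_prop))
    · exact measurableSet_setOfPred.1 (measurable_fst (FrogRCM.measurableSet_cluster_infinite x))
    · exact measurableSet_setOfPred.1 (hrec x)
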